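/- **Setting.** For each $n\ge 1$ let $\mathcal X_n$ be a measurable space, $k_n:\mathcal X_n\times\mathcal X_n\to\mathbb R$ a (jointly measurable) positive definite kernel with reproducing kernel Hilbert space $\mathcal H_n$, and $m_n$ a sample size. Let $\mathcal P_n^{(0)}$ be a nonempty family of probability distributions on $\mathcal X_n$, each of which has a mean embedding $\mu_P\in\mathcal H_n$, i.e. every $f\in\mathcal H_n$ is $P$-integrable and $\langle \mu_P,f\rangle=\int f\,dP$ for all $f\in\mathcal H_n$. For $P_n\in\mathcal P_n^{(0)}$ write $\bar k_n(x,y)=\langle k_n(x,\cdot)-\mu_{P_n},\,k_n(y,\cdot)-\mu_{P_n}\rangle$, and let $\lambda_{1,n}\ge\lambda_{2,n}\ge\dots\ge 0$ be the eigenvalues, repeated according to multiplicity (and padded with zeros if there are finitely many), of the integral operator $g\mapsto\int\bar k_n(\cdot,x)g(x)\,dP_n(x)$ on $L^2(P_n)$. **Statistic.** Let $X_1,\dots,X_n,Y_1,\dots,Y_m$ ($m=m_n$) be i.i.d. from $P_n$ (the null hypothesis). Put $n_1=\lfloor n/2\rfloor$, $n_2=n-n_1$, $m_1=\lfloor m/2\rfloor$,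 $m_2=m-m_1$, and $h(x,x',y,y')=k_n(x,x')-k_n(x,y')-k_n(y,x')+k_n(y,y')$. Define $$\mathrm{xMMD}^2=\frac1{n_1m_1n_2m_2}\sum_{i\le n_1}\ \sum_{n_1<i'\le n}\ \sum_{j\le m_1}\ \sum_{m_1<j'\le m}h(X_i,X_{i'},Y_j,Y_{j'}).$$ With $\hat\mu_2=\frac1{n_2}\sum_{i'>n_1}k_n(X_{i'},\cdot)$, $\hat\nu_2=\frac1{m_2}\sum_{j'>m_1}k_n(Y_{j'},\cdot)$, $U_{X,i}=\langle k_n(X_i,\cdot),\hat\mu_2-\hat\nu_2\rangle$ for $i\le n_1$ and $U_{Y,j}=\langle k_n(Y_j,\cdot),\hat\mu_2-\hat\nu_2\rangle$ for $j\le m_1$, and with $\bar U_X,\bar U_Y$ the sample means of these, put $$\hat\sigma^2=\frac1{n_1}\cdot\frac1{n_1}\sum_{i\le n_1}(U_{X,i}-\bar U_X)^2+\frac1{m_1}\cdot\frac1{m_1}\sum_{j\le m_1}(U_{Y,j}-\bar U_Y)^2 .$$ **Theorem.** Suppose that $\lim_{n\to\infty}n/m_n$ exists in $\mathbb R$ and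 is non-zero. Suppose that every sequence $(P_n)_{n\ge1}$ with $P_n\in\mathcal P_n^{(0)}$ for all $n\ge1$ satisfies the following, where $X_1,X_2,X_3$ are i.i.d. from $P_n$: 1. for all large $n$, $\mathbb E_{P_n}[\bar k_n^4(X_1,X_2)]<\infty$ and $\mathbb E_{P_n}[\bar k_n^2(X_1,X_2)]\neq0$, and $$\frac{\mathbb E_{P_n}[\bar k_n^4(X_1,X_2)]\,(n^{-1}+m_n^{-1})+\mathbb E_{P_n}[\bar k_n^2(X_1,X_3)\bar k_n^2(X_2,X_3)]}{\mathbb E_{P_n}[\bar k_n^2(X_1,X_2)]^2\left(\frac1{n^{-1}+m_n^{-1}}\right)}\longrightarrow 0;$$ 2. $\displaystyle\lim_{n\to\infty}\frac{\lambda_{1,n}^2}{\sum_{l\ge1}\lambda_{l,n}^2}$ exists. Then $$\lim_{n\to\infty}\ \sup_{P_n\in\mathcal P_n^{(0)}}\ \sup_{x\in\mathbb R}\left|\mathbb P_{P_n}\!\left(\frac{\mathrm{xMMD}^2}{\hat\sigma}\le x\right)-\Phi(x)\right|=0,$$ where $\Phi$ is the standard normal distribution function. -/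

import Mathlib

open MeasureTheory ProbabilityTheory Filter Topology

noncomputable section

namespace CrossMMD

/-- A positive definite kernel on `X` in the sense of reproducing kernel Hilbert spaces: a
symmetric real function all of whose finite Gram matrices are positive semidefinite. -/
structure PosDefKernel (X : Type*) where
  toFun : X → X → ℝ
  posSemidef : (Matrix.of toFun).PosSemidef

namespace PosDefKernel

section

variable {X : Type*} (k : PosDefKernel X)

/-- The kernel with its values viewed as operators on `ℝ`, which is the form in which Mathlib
builds the reproducing kernel Hilbert space of a kernel. -/
def opMatrix : Matrix X X (ℝ →L[ℝ] ℝ) :=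
  Matrix.of fun x y => k.toFun x y • (1 : ℝ →L[ℝ] ℝ)

theorem symm (x y : X) : k.toFun x y = k.toFun y x := by
  simpa using k.posSemidef.1.apply y x

theorem opMatrix_posSemidef : k.opMatrix.PosSemidef := by
  have key : k.opMatrix.IsHermitian ∧ ∀ v : X →₀ ℝ, 0 ≤ RCLike.re
      (v.sum fun x w => v.sum fun x' w' => inner ℝ (k.opMatrix x' x w) w') := by
    refine ⟨?_, fun v => ?_⟩
    · ext x y
      simp [opMatrix, k.symm x y]
    · have h := k.posSemidef.2 v
      simp only [opMatrix, Matrix.of_apply, star_trivial] at h ⊢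
      refine h.trans_eq ?_
      simp only [Finsupp.sum, RCLike.re_to_real]
      refine Finset.sum_congr rfl fun x _ => Finset.sum_congr rfl fun y _ => ?_
      simp [k.symm x y]
      ring
  exact ((RKHS.posSemidef_tfae (𝕜 := ℝ) (K := k.opMatrix)).out 0 2).2 key

instance instFactPosSemidef : Fact k.opMatrix.PosSemidef := Fact.mk k.opMatrix_posSemidef

/-- The reproducing kernel Hilbert space of `k`. -/
abbrev H : Type _ := RKHS.OfKernel k.opMatrix

/-- The element `k(x, ·)` of the reproducing kernel Hilbert space. -/
def feature (x : X) : k.H := RKHS.kerFun k.H x (1 : ℝ)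

theorem inner_feature (x : X) (f : k.H) : inner ℝ (k.feature x) f = f x := by
  simp [feature]

theorem feature_apply (x y : X) : k.feature x y = k.toFun x y := by
  rw [feature, RKHS.kerFun_apply, RKHS.OfKernel.kernel_ofKernel]
  simp [opMatrix, k.symm x y]

end

section

variable {X : Type*} [MeasurableSpace X] (k : PosDefKernel X)

/-- `μ` is the embedding of `P` into the reproducing kernel Hilbert space: every function of the
space is `P`-integrable, and `μ` represents integration against `P`. In particular
`μ(y) = ∫ k(x, y) dP(x)`. -/
def IsMeanEmbedding (P : Measure X) (μ : k.H) : Prop :=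
  ∀ f : k.H, Integrable (fun x => f x) P ∧ inner ℝ μ f = ∫ x, f x ∂P

/-- The embedding of `P`; it is unique whenever there is one. -/
def meanEmbedding (P : Measure X) : k.H := Classical.epsilon (k.IsMeanEmbedding P)

/-- The centred kernel `⟨k(x, ·) - μ_P, k(y, ·) - μ_P⟩`. -/
def centered (P : Measure X) (x y : X) : ℝ :=
  inner ℝ (k.feature x - k.meanEmbedding P) (k.feature y - k.meanEmbedding P)

end

section

variable {X : Type*} (k : PosDefKernel X)

/-- `h(x, x', y, y') = k(x, x') - k(x, y') - k(y, x') + k(y, y')`. -/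
def hFun (x x' y y' : X) : ℝ :=
  k.toFun x x' - k.toFun x y' - k.toFun y x' + k.toFun y y'

/-- The empirical embedding `r⁻¹ ∑ k(z_i, ·)` of a sample of size `r`. -/
def empEmbedding {r : ℕ} (z : Fin r → X) : k.H := (r : ℝ)⁻¹ • ∑ i, k.feature (z i)

end

end PosDefKernel

/-! ### The statistic -/

section

variable {X : Type*}

/-- The first `⌊r/2⌋` points of a sample of size `r`. -/
def firstHalf {r : ℕ} (z : Fin r → X) : Fin (r / 2) → X :=
  fun i => z ⟨i.1, by omega⟩

/-- The remaining `r - ⌊r/2⌋` points of a sample of size `r`. -/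
def secondHalf {r : ℕ} (z : Fin r → X) : Fin (r - r / 2) → X :=
  fun i => z ⟨r / 2 + i.1, by omega⟩

variable (k : PosDefKernel X) {n m : ℕ}

/-- The cross-MMD statistic `xMMD²`. -/
def xMMDsq (x : Fin n → X) (y : Fin m → X) : ℝ :=
  (((n / 2 : ℕ) : ℝ) * ((m / 2 : ℕ) : ℝ) * ((n - n / 2 : ℕ) : ℝ) * ((m - m / 2 : ℕ) : ℝ))⁻¹ *
    ∑ i, ∑ i', ∑ j, ∑ j',
      k.hFun (firstHalf x i) (secondHalf x i') (firstHalf y j) (secondHalf y j')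

/-- `⟨k(z, ·), μ̂₂ - ν̂₂⟩`, with the empirical embeddings of the second halves of the samples. -/
def uStat (x : Fin n → X) (y : Fin m → X) (z : X) : ℝ :=
  inner ℝ (k.feature z) (k.empEmbedding (secondHalf x) - k.empEmbedding (secondHalf y))

/-- The mean of finitely many reals. -/
def empMean {r : ℕ} (u : Fin r → ℝ) : ℝ := (r : ℝ)⁻¹ * ∑ i, u i

/-- The empirical variance (with normalization `1 / r`) of finitely many reals. -/
def empVar {r : ℕ} (u : Fin r → ℝ) : ℝ := (r : ℝ)⁻¹ * ∑ i, (u i - empMean u) ^ 2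

/-- `σ̂² = σ̂_X² / n₁ + σ̂_Y² / m₁`. -/
def sigmaHatSq (x : Fin n → X) (y : Fin m → X) : ℝ :=
  ((n / 2 : ℕ) : ℝ)⁻¹ * empVar (fun i => uStat k x y (firstHalf x i)) +
    ((m / 2 : ℕ) : ℝ)⁻¹ * empVar (fun j => uStat k x y (firstHalf y j))

/-- The studentized cross-MMD statistic `xMMD² / σ̂`. -/
def studentizedXMMD (x : Fin n → X) (y : Fin m → X) : ℝ :=
  xMMDsq k x y / Real.sqrt (sigmaHatSq k x y)

/-- The joint law, under the null hypothesis, of two independent i.i.d. samples of sizes `n` and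
`m` from `P`. -/
def sampleLaw [MeasurableSpace X] (P : Measure X) (n m : ℕ) :
    Measure ((Fin n → X) × (Fin m → X)) :=
  (Measure.pi fun _ : Fin n => P).prod (Measure.pi fun _ : Fin m => P)

/-- `sup_x |ℙ(xMMD² / σ̂ ≤ x) - Φ(x)|` for samples of sizes `n` and `m` from `P`. -/
def kolmogorovDist [MeasurableSpace X] (P : Measure X) (n m : ℕ) : ℝ :=
  ⨆ t : ℝ, |(sampleLaw P n m).real {s | studentizedXMMD k s.1 s.2 ≤ t} -
    cdf (gaussianReal 0 1) t|

end

/-! ### Eigenvalues of the integral operator and the moment condition -/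

section

variable {X : Type*} [MeasurableSpace X]

/-- `g` is in the eigenspace, for the eigenvalue `s`, of the integral operator
`g ↦ ∫ K(·, y) g(y) dP(y)` on `L²(P)`. -/
def IsEigenfunction (K : X → X → ℝ) (P : Measure X) (s : ℝ) (g : Lp ℝ 2 P) : Prop :=
  ∀ᵐ x ∂P, ∫ y, K x y * g y ∂P = s * g x

/-- The positive eigenvalues of the integral operator of `K` on `L²(P)` in decreasing order and
repeated according to multiplicity, followed by zeros if there are only finitely many: the `l`-th
one (counting from `l = 0`) is the largest `t > 0` such that the eigenspaces for eigenvalues at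
least `t` span a space of dimension at least `l + 1`. -/
def eigenvalue (K : X → X → ℝ) (P : Measure X) (l : ℕ) : ℝ :=
  sSup {t : ℝ | 0 < t ∧ ((l + 1 : ℕ) : Cardinal) ≤
    Module.rank ℝ (Submodule.span ℝ {g : Lp ℝ 2 P | ∃ s, t ≤ s ∧ IsEigenfunction K P s g})}

/-- `𝔼[K(X₁, X₂)^p]` for independent `X₁, X₂ ∼ P`. -/
def pairMoment (K : X → X → ℝ) (P : Measure X) (p : ℕ) : ℝ :=
  ∫ z : X × X, K z.1 z.2 ^ p ∂(P.prod P)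

/-- `𝔼[K(X₁, X₃)² K(X₂, X₃)²]` for independent `X₁, X₂, X₃ ∼ P`. -/
def tripleMoment (K : X → X → ℝ) (P : Measure X) : ℝ :=
  ∫ z : X × X × X, K z.1 z.2.2 ^ 2 * K z.2.1 z.2.2 ^ 2 ∂(P.prod (P.prod P))

/-- The assumption on a sequence of kernels and distributions: the moment ratio is eventually
meaningful (finite fourth moment, nonzero second moment) and tends to `0`, and the eigenvalue ratio
`λ₁² / ∑ λ_l²` has a limit. -/
structure KernelAssumption {𝒳 : ℕ → Type*} [∀ n, MeasurableSpace (𝒳 n)] (m : ℕ → ℕ)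
    (K : ∀ n, 𝒳 n → 𝒳 n → ℝ) (P : ∀ n, Measure (𝒳 n)) : Prop where
  fourth_moment : ∀ᶠ n in atTop,
    Integrable (fun z : 𝒳 n × 𝒳 n => K n z.1 z.2 ^ 4) ((P n).prod (P n))
  second_moment : ∀ᶠ n in atTop, pairMoment (K n) (P n) 2 ≠ 0
  moment_ratio : Tendsto (fun n : ℕ =>
    (pairMoment (K n) (P n) 4 * ((n : ℝ)⁻¹ + (m n : ℝ)⁻¹) + tripleMoment (K n) (P n)) /
      (pairMoment (K n) (P n) 2 ^ 2 * (1 / ((n : ℝ)⁻¹ + (m n : ℝ)⁻¹)))) atTop (𝓝 0)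
  eigenvalue_ratio : ∃ ρ : ℝ, Tendsto (fun n : ℕ =>
    eigenvalue (K n) (P n) 0 ^ 2 / ∑' l : ℕ, eigenvalue (K n) (P n) l ^ 2) atTop (𝓝 ρ)

end

end CrossMMD

end

/-!
The studentized statistic depends on the first halves of the samples only through the function
`f = linStat K w v`, `f(x) = ∑ wᵢ K(x, vᵢ)`, where `K` is the centred kernel, `v` collects the
second halves of both samples and `w` are the weights `contrast` of a difference of two sample means
(`studentizedXMMD_eq`). Conditionally on `v` it is the two-sample t-statistic of the centred
function `f`. Hence it is asymptotically standard normal as soon as `f` satisfies the Lyapunov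
condition `∫ f⁴ ≪ r (∫ f²)²`, `r` being the smaller of the sizes of the two first halves
(`exists_abs_real_tStatistic_sub_cdf_le`); the error depends only on the Lyapunov ratio, so that no
uniformity is lost by conditioning.

It remains to see that the Lyapunov condition holds with high probability in `v`
(`exists_real_not_isRegularSample_le`). The expectation of `∫ f⁴` is at most
`(∑ wᵢ⁴) 𝔼 K⁴ + 3 (∑ wᵢ²)² 𝔼 K²(X₁, X₃) K²(X₂, X₃)`, which the moment ratio controls, and that of
`∫ f²` is `(∑ wᵢ²) 𝔼 K²`. What is needed is a small-ball estimate: the quadratic statistic `∫ f²`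
is rarely much smaller than its mean (`exists_real_condSecond_le`). With the iterated kernel
`κ(x, y) = ∫ K(x, z) K(y, z) dP(z)` there are two cases.

* If `𝔼 κ² ≤ ρ (𝔼 K²)²` for a small `ρ`, then the variance of `∫ f²` is small relative to the square
  of its mean, and Chebyshev's inequality suffices.
* Otherwise some row `κ(·, y)` has a second moment exceeding `ρ (𝔼 K²) ∫ K(y, ·)²`. By the
  Cauchy–Schwarz inequality, `(∑ wᵢ κ(vᵢ, y))² ≤ (∫ f²) ∫ K(y, ·)²`, and the linear statistic on the
  left is asymptotically normal by the central limit theorem, so that it rarely is close to `0`.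

Since `𝔼 κ² = ∑ λ_l⁴` and `𝔼 K² = ∑ λ_l²`, this dichotomy plays the role of a distinction according
to the limit of `λ₁² / ∑ λ_l²`, but it is made for each sample size separately and without spectral
theory.

All estimates are uniform in the distribution, so the supremum over the family is handled by
applying the assumption to a sequence of nearly worst distributions.
-/

noncomputable section

namespace CrossMMD

universe u

/-! ### A Lyapunov central limit theorem with uniform error -/

theorem norm_exp_mul_I_sub_le (x : ℝ) :
    ‖Complex.exp (x * Complex.I) - (1 + x * Complex.I - (x : ℂ) ^ 2 / 2)‖ ≤ 4 * |x| ^ 3 := by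
  have hn : ‖(x : ℂ) * Complex.I‖ = |x| := by simp
  rcases le_total |x| 1 with h | h
  · have := Complex.exp_bound (x := x * Complex.I) (by rw [hn]; exact h) (n := 3) (by norm_num)
    rw [hn] at this
    have e : ∑ m ∈ Finset.range 3, ((x : ℂ) * Complex.I) ^ m / (m.factorial : ℂ)
        = 1 + x * Complex.I - (x : ℂ) ^ 2 / 2 := by
      simp [Finset.sum_range_succ, mul_pow, Nat.factorial]
      ring
    rw [e] at this
    refine this.trans ?_
    have h3 : 0 ≤ |x| ^ 3 := by positivity
    norm_num [Nat.factorial]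
    nlinarith
  · have h1 : ‖Complex.exp (x * Complex.I)‖ = 1 := Complex.norm_exp_ofReal_mul_I x
    have h2 : ‖(1 + x * Complex.I - (x : ℂ) ^ 2 / 2)‖ ≤ 1 + |x| + |x| ^ 2 / 2 := by
      refine (norm_sub_le _ _).trans (add_le_add ((norm_add_le _ _).trans ?_) ?_)
      · simp
      · simp
    refine (norm_sub_le _ _).trans ?_
    rw [h1]
    have h3 : |x| ≤ |x| ^ 2 := by nlinarith
    have h4 : |x| ^ 2 ≤ |x| ^ 3 := by nlinarith
    linarith

theorem abs_exp_neg_sub_le {y : ℝ} (hy : 0 ≤ y) : |Real.exp (-y) - (1 - y)| ≤ y ^ 2 := by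
  rcases le_total y 1 with h | h
  · have := Real.abs_exp_sub_one_sub_id_le (x := -y) (by rwa [abs_neg, abs_of_nonneg hy])
    rw [show Real.exp (-y) - (1 - y) = Real.exp (-y) - 1 - -y by ring]
    simpa using this
  · have h1 := Real.add_one_le_exp (-y)
    have h2 : Real.exp (-y) ≤ 1 := Real.exp_le_one_iff.2 (by linarith)
    rw [abs_of_nonneg (by linarith)]
    nlinarith

theorem norm_prod_sub_prod_le {ι : Type*} (s : Finset ι) (a b : ι → ℂ)
    (ha : ∀ i, ‖a i‖ ≤ 1) (hb : ∀ i, ‖b i‖ ≤ 1) :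
    ‖∏ i ∈ s, a i - ∏ i ∈ s, b i‖ ≤ ∑ i ∈ s, ‖a i - b i‖ := by
  classical
  induction s using Finset.induction_on with
  | empty => simp
  | insert i s hi ih =>
    rw [Finset.prod_insert hi, Finset.prod_insert hi, Finset.sum_insert hi]
    have e : a i * ∏ j ∈ s, a j - b i * ∏ j ∈ s, b j
        = (a i - b i) * ∏ j ∈ s, a j + b i * (∏ j ∈ s, a j - ∏ j ∈ s, b j) := by ring
    have hs : ‖∏ j ∈ s, a j‖ ≤ 1 := by
      rw [norm_prod]
      exact Finset.prod_le_one (fun _ _ => norm_nonneg _) fun j _ => ha j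
    rw [e]
    refine (norm_add_le _ _).trans (add_le_add ?_ ?_)
    · rw [norm_mul]
      exact mul_le_of_le_one_right (norm_nonneg _) hs
    · rw [norm_mul]
      exact (mul_le_of_le_one_left (norm_nonneg _) (hb i)).trans ih

section Moments

variable {X : Type*} [MeasurableSpace X] {P : Measure X} [IsProbabilityMeasure P] {f : X → ℝ}

theorem integrable_pow_of_integrable_pow_four (hf : Measurable f)
    (h4 : Integrable (fun x => f x ^ 4) P) {p : ℕ} (hp : p ≤ 4) :
    Integrable (fun x => f x ^ p) P := by
  refine Integrable.mono' (h4.add (integrable_const 1)) (hf.pow_const p).aestronglyMeasurable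
    (ae_of_all _ fun x => ?_)
  have h0 := abs_nonneg (f x)
  have e4 : f x ^ 4 = |f x| ^ 4 := (Even.pow_abs (by decide) _).symm
  simp only [Pi.add_apply, Real.norm_eq_abs, abs_pow]
  rw [e4]
  rcases le_total |f x| 1 with h | h
  · have := pow_le_one₀ h0 h (n := p)
    have : 0 ≤ |f x| ^ 4 := by positivity
    linarith
  · have := pow_le_pow_right₀ h hp
    linarith

theorem integrable_of_integrable_pow_four (hf : Measurable f)
    (h4 : Integrable (fun x => f x ^ 4) P) : Integrable f P := by
  simpa using integrable_pow_of_integrable_pow_four hf h4 (p := 1) (by norm_num)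

theorem sq_integral_sq_le (hf : Measurable f) (h4 : Integrable (fun x => f x ^ 4) P) :
    (∫ x, f x ^ 2 ∂P) ^ 2 ≤ ∫ x, f x ^ 4 ∂P := by
  have h2 := integrable_pow_of_integrable_pow_four hf h4 (p := 2) (by norm_num)
  set V := ∫ x, f x ^ 2 ∂P
  have h : 0 ≤ ∫ x, (f x ^ 4 - 2 * V * f x ^ 2 + V ^ 2) ∂P :=
    integral_nonneg fun x => by
      have := sq_nonneg (f x ^ 2 - V)
      simp only [Pi.zero_apply]
      nlinarith
  rw [integral_add (f := fun x => f x ^ 4 - 2 * V * f x ^ 2) (h4.sub (h2.const_mul _))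
    (integrable_const _), integral_sub h4 (h2.const_mul _), integral_const_mul] at h
  simp at h
  change 0 ≤ _ - 2 * V * V + V ^ 2 at h
  linarith

/-- Comparison of the characteristic function of a centred variable with that of a normal variable
of the same variance. The parameter `s` balances the second against the fourth moment in
`|x|³ ≤ (s x² + x⁴ / s) / 2`. -/
theorem norm_integral_exp_sub_exp_le (hf : Measurable f) (h4 : Integrable (fun x => f x ^ 4) P)
    (h0 : ∫ x, f x ∂P = 0) (v : ℝ) {s : ℝ} (hs : 0 < s) :
    ‖∫ x, Complex.exp ((v * f x : ℝ) * Complex.I) ∂P -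
        (Real.exp (-(v ^ 2 * ∫ x, f x ^ 2 ∂P) / 2) : ℂ)‖ ≤
      2 * (s * (v ^ 2 * ∫ x, f x ^ 2 ∂P) + v ^ 4 * (∫ x, f x ^ 4 ∂P) / s) +
        v ^ 4 * ∫ x, f x ^ 4 ∂P := by
  have h1 := integrable_of_integrable_pow_four hf h4
  have h2 := integrable_pow_of_integrable_pow_four hf h4 (p := 2) (by norm_num)
  set V := ∫ x, f x ^ 2 ∂P with hV
  set M := ∫ x, f x ^ 4 ∂P with hM
  have hVM : V ^ 2 ≤ M := sq_integral_sq_le hf h4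
  have hV0 : 0 ≤ V := integral_nonneg fun x => sq_nonneg _
  have iexp : Integrable (fun x => Complex.exp ((v * f x : ℝ) * Complex.I)) P := by
    refine Integrable.of_bound (C := 1) ?_ (ae_of_all _ fun x => ?_)
    · exact Measurable.aestronglyMeasurable (by fun_prop)
    · rw [Complex.norm_exp_ofReal_mul_I]
  have ipoly : Integrable (fun x => (1 + ((v * f x : ℝ) : ℂ) * Complex.I
      - ((v * f x : ℝ) : ℂ) ^ 2 / 2)) P := by
    refine ((integrable_const _).add ((h1.const_mul v).ofReal.mul_const _)).sub ?_
    have := ((h2.const_mul (v ^ 2)).ofReal (𝕜 := ℂ)).div_const 2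
    refine this.congr (ae_of_all _ fun x => ?_)
    simp
    ring
  have epoly : ∫ x, (1 + ((v * f x : ℝ) : ℂ) * Complex.I
      - ((v * f x : ℝ) : ℂ) ^ 2 / 2) ∂P = ((1 - v ^ 2 * V / 2 : ℝ) : ℂ) := by
    have e : ∀ x, (1 + ((v * f x : ℝ) : ℂ) * Complex.I - ((v * f x : ℝ) : ℂ) ^ 2 / 2)
        = ((1 - v ^ 2 / 2 * f x ^ 2 : ℝ) : ℂ) + ((v * f x : ℝ) : ℂ) * Complex.I := by
      intro x; push_cast; ring
    simp_rw [e]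
    rw [integral_add, integral_mul_const, integral_complex_ofReal, integral_complex_ofReal,
      integral_sub (integrable_const _) (h2.const_mul _), integral_const_mul, integral_const_mul,
      h0]
    · simp [← hV]; ring
    · exact ((integrable_const (1 : ℝ)).sub (h2.const_mul _)).ofReal
    · exact (h1.const_mul v).ofReal.mul_const _
  have hA : ‖∫ x, Complex.exp ((v * f x : ℝ) * Complex.I) ∂P - ((1 - v ^ 2 * V / 2 : ℝ) : ℂ)‖ ≤
      2 * (s * (v ^ 2 * V) + v ^ 4 * M / s) := by
    rw [← epoly, ← integral_sub iexp ipoly]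
    have hb : ∀ x, ‖Complex.exp ((v * f x : ℝ) * Complex.I) - (1 + ((v * f x : ℝ) : ℂ) * Complex.I
        - ((v * f x : ℝ) : ℂ) ^ 2 / 2)‖ ≤ 2 * s * v ^ 2 * f x ^ 2 + 2 * v ^ 4 / s * f x ^ 4 := by
      intro x
      refine (norm_exp_mul_I_sub_le _).trans ?_
      set y := v * f x
      have hy : 2 * |y| ^ 3 ≤ s * y ^ 2 + y ^ 4 / s := by
        have e : s * y ^ 2 + y ^ 4 / s - 2 * |y| ^ 3 = |y| ^ 2 * (s - |y|) ^ 2 / s := by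
          have e2 : y ^ 2 = |y| ^ 2 := (sq_abs y).symm
          have e4 : y ^ 4 = |y| ^ 4 := (Even.pow_abs (by decide) _).symm
          rw [e2, e4]; field_simp; ring
        have : 0 ≤ |y| ^ 2 * (s - |y|) ^ 2 / s := by positivity
        linarith
      have e : 2 * s * v ^ 2 * f x ^ 2 + 2 * v ^ 4 / s * f x ^ 4 = 2 * (s * y ^ 2 + y ^ 4 / s) := by
        simp only [y]; ring
      rw [e]; linarith
    refine (norm_integral_le_of_norm_le ((h2.const_mul (2 * s * v ^ 2)).add
      (h4.const_mul (2 * v ^ 4 / s))) (ae_of_all _ hb)).trans_eq ?_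
    simp only [Pi.add_apply]
    rw [integral_add (h2.const_mul _) (h4.const_mul _), integral_const_mul, integral_const_mul,
      ← hV, ← hM]
    ring
  have hB : ‖((1 - v ^ 2 * V / 2 : ℝ) : ℂ) - (Real.exp (-(v ^ 2 * V) / 2) : ℂ)‖ ≤ v ^ 4 * M := by
    rw [← Complex.ofReal_sub, Complex.norm_real, Real.norm_eq_abs, abs_sub_comm, neg_div]
    refine (abs_exp_neg_sub_le (by positivity)).trans ?_
    have : v ^ 4 * V ^ 2 ≤ v ^ 4 * M := mul_le_mul_of_nonneg_left hVM (by positivity)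
    nlinarith [mul_nonneg (pow_nonneg (sq_nonneg v) 2) (sq_nonneg V)]
  calc _ = ‖(∫ x, Complex.exp ((v * f x : ℝ) * Complex.I) ∂P - ((1 - v ^ 2 * V / 2 : ℝ) : ℂ)) +
        (((1 - v ^ 2 * V / 2 : ℝ) : ℂ) - (Real.exp (-(v ^ 2 * V) / 2) : ℂ))‖ := by
        congr 1; ring
    _ ≤ _ := (norm_add_le _ _).trans (add_le_add hA hB)

theorem norm_charFun_sum_sub_exp_le {ι : Type*} [Fintype ι] (w : ι → ℝ)
    (hf : Measurable f) (h4 : Integrable (fun x => f x ^ 4) P)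
    (h0 : ∫ x, f x ∂P = 0) (hV : (∑ i, w i ^ 2) * ∫ x, f x ^ 2 ∂P = 1) {δ : ℝ} (hδ : 0 < δ)
    (hM : (∑ i, w i ^ 4) * ∫ x, f x ^ 4 ∂P ≤ δ) (v : ℝ) :
    ‖charFun ((Measure.pi fun _ : ι => P).map fun z => ∑ i, w i * f (z i)) v -
        (Real.exp (-v ^ 2 / 2) : ℂ)‖ ≤ 2 * (v ^ 2 + v ^ 4) * √δ + v ^ 4 * δ := by
  -- `√δ` balances the contributions of the second and the fourth moments
  have hs : 0 < √δ := Real.sqrt_pos.2 hδ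
  have e1 : charFun ((Measure.pi fun _ : ι => P).map fun z => ∑ i, w i * f (z i)) v
      = ∏ i, ∫ x, Complex.exp (((v * w i) * f x : ℝ) * Complex.I) ∂P := by
    rw [charFun_apply_real, integral_map (Measurable.aemeasurable (by fun_prop))
      (Measurable.aestronglyMeasurable (by fun_prop)), ← integral_fintype_prod_eq_prod]
    congr 1
    ext z
    rw [← Complex.exp_sum]
    congr 1
    push_cast
    rw [Finset.mul_sum, Finset.sum_mul]
    exact Finset.sum_congr rfl fun i _ => by ring
  have e2 : (Real.exp (-v ^ 2 / 2) : ℂ)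
      = ∏ i, (Real.exp (-((v * w i) ^ 2 * ∫ x, f x ^ 2 ∂P) / 2) : ℂ) := by
    rw [← Complex.ofReal_prod, ← Real.exp_sum]
    congr 2
    rw [← Finset.sum_div, Finset.sum_neg_distrib, ← Finset.sum_mul]
    simp_rw [mul_pow]
    rw [← Finset.mul_sum, mul_assoc, hV, mul_one]
  rw [e1, e2]
  refine (norm_prod_sub_prod_le _ _ _ (fun i => ?_) fun i => ?_).trans ?_
  · refine (norm_integral_le_of_norm_le (integrable_const 1) (ae_of_all _ fun x => ?_)).trans ?_
    · rw [Complex.norm_exp_ofReal_mul_I]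
    · simp
  · rw [Complex.norm_real, Real.norm_eq_abs, Real.abs_exp]
    refine Real.exp_le_one_iff.2 ?_
    have : 0 ≤ ∫ x, f x ^ 2 ∂P := integral_nonneg fun x => sq_nonneg _
    have : 0 ≤ (v * w i) ^ 2 * ∫ x, f x ^ 2 ∂P := by positivity
    linarith
  refine (Finset.sum_le_sum fun i _ => norm_integral_exp_sub_exp_le hf h4 h0 (v * w i) hs).trans ?_
  set V := ∫ x, f x ^ 2 ∂P
  set M := ∫ x, f x ^ 4 ∂P
  have e3 : ∑ i, (2 * (√δ * ((v * w i) ^ 2 * V) + (v * w i) ^ 4 * M / √δ) + (v * w i) ^ 4 * M)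
      = 2 * √δ * v ^ 2 * ((∑ i, w i ^ 2) * V) +
        (2 * v ^ 4 / √δ + v ^ 4) * ((∑ i, w i ^ 4) * M) := by
    simp_rw [Finset.sum_mul, Finset.mul_sum]
    rw [← Finset.sum_add_distrib]
    exact Finset.sum_congr rfl fun i _ => by ring
  rw [e3, hV]
  have h5 : (2 * v ^ 4 / √δ + v ^ 4) * ((∑ i, w i ^ 4) * M) ≤ (2 * v ^ 4 / √δ + v ^ 4) * δ :=
    mul_le_mul_of_nonneg_left hM (by positivity)
  have h6 : 2 * v ^ 4 / √δ * δ = 2 * v ^ 4 * √δ := by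
    rw [div_mul_eq_mul_div, div_eq_iff hs.ne', mul_assoc _ (√δ), Real.mul_self_sqrt hδ.le]
  nlinarith

end Moments

section Gaussian

theorem gaussianPDFReal_le_one (x : ℝ) : gaussianPDFReal 0 1 x ≤ 1 := by
  rw [gaussianPDFReal]
  refine mul_le_one₀ ?_ (Real.exp_nonneg _) (Real.exp_le_one_iff.2 ?_)
  · refine inv_le_one_of_one_le₀ (Real.one_le_sqrt.2 ?_)
    have := Real.pi_gt_three
    simp; linarith
  · rw [neg_div]
    have : 0 ≤ (x - 0) ^ 2 / (2 * ((1 : NNReal) : ℝ)) := by positivity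
    linarith

theorem cdf_gaussianReal_sub_le {s t : ℝ} (h : s ≤ t) :
    cdf (gaussianReal 0 1) t - cdf (gaussianReal 0 1) s ≤ t - s := by
  rw [cdf_eq_real, cdf_eq_real, ← measureReal_sdiff (Set.Iic_subset_Iic.2 h) measurableSet_Iic,
    Set.Iic_sdiff_Iic, measureReal_def]
  refine ENNReal.toReal_le_of_le_ofReal (by linarith) ?_
  rw [gaussianReal_of_var_ne_zero _ one_ne_zero, withDensity_apply _ measurableSet_Ioc,
    ← Real.volume_Ioc]
  refine (lintegral_mono (g := fun _ => 1) fun x => ?_).trans (by simp)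
  rw [gaussianPDF]
  exact ENNReal.ofReal_le_one.2 (gaussianPDFReal_le_one x)

theorem exists_cdf_gaussianReal_tails {ε : ℝ} (hε : 0 < ε) :
    ∃ A : ℝ, 0 < A ∧ cdf (gaussianReal 0 1) (-A) ≤ ε ∧ 1 - ε ≤ cdf (gaussianReal 0 1) A := by
  have h1 := (tendsto_cdf_atBot (gaussianReal 0 1)).comp tendsto_neg_atTop_atBot
  have h2 := tendsto_cdf_atTop (gaussianReal 0 1)
  have h3 := (h1.eventually (ge_mem_nhds hε)).and
    ((h2.eventually (le_mem_nhds (show 1 - ε < 1 by linarith))).and (eventually_gt_atTop 0))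
  obtain ⟨A, hA1, hA2, hA3⟩ := h3.exists
  exact ⟨A, hA3, hA1, hA2⟩

/-- **Pólya's theorem** for the normal limit: weak convergence is uniform on the level of
distribution functions, because the limit is continuous. -/
theorem eventually_abs_cdf_sub_le {μ : ℕ → ProbabilityMeasure ℝ}
    (h : Tendsto μ atTop (𝓝 ⟨gaussianReal 0 1, inferInstance⟩)) {ε : ℝ} (hε : 0 < ε) :
    ∀ᶠ N in atTop, ∀ t : ℝ,
      |cdf (μ N : Measure ℝ) t - cdf (gaussianReal 0 1) t| ≤ ε := by
  have hpt : ∀ t : ℝ, Tendsto (fun N => cdf (μ N : Measure ℝ) t) atTop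
      (𝓝 (cdf (gaussianReal 0 1) t)) := by
    intro t
    have := nullSingletonClass_gaussianReal (μ := 0) (v := 1) one_ne_zero
    have := ProbabilityMeasure.tendsto_measure_of_null_frontier_of_tendsto' h (E := Set.Iic t)
      (by simp)
    simp_rw [cdf_eq_real, measureReal_def]
    exact (ENNReal.tendsto_toReal (measure_ne_top _ _)).comp this
  obtain ⟨A, hA, hA1, hA2⟩ := exists_cdf_gaussianReal_tails (show 0 < ε / 2 by linarith)
  -- by monotonicity and the Lipschitz bound for `Φ`, it suffices to compare the distribution
  -- functions on a finite grid of mesh `η` covering `[-A, A]`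
  set η := ε / 2 with hη
  have hη0 : 0 < η := by positivity
  have hgrid : ∀ᶠ N in atTop, ∀ j ∈ Finset.range (⌊2 * A / η⌋₊ + 2),
      |cdf (μ N : Measure ℝ) (-A + j * η) - cdf (gaussianReal 0 1) (-A + j * η)| ≤ η := by
    rw [Filter.eventually_all_finset]
    intro j _
    filter_upwards [Metric.tendsto_nhds.1 (hpt (-A + j * η)) η hη0] with N hN
    exact hN.le
  filter_upwards [hgrid] with N hN t
  have hm := monotone_cdf (μ N : Measure ℝ)
  have hg := monotone_cdf (gaussianReal 0 1)
  have hub := cdf_le_one (μ N : Measure ℝ) t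
  have hlb := cdf_nonneg (μ N : Measure ℝ) t
  have gub := cdf_le_one (gaussianReal 0 1) t
  have glb := cdf_nonneg (gaussianReal 0 1) t
  rcases lt_or_ge t (-A) with ht | ht
  · have h0 := abs_le.1 (hN 0 (by simp))
    simp only [Nat.cast_zero, zero_mul, add_zero] at h0
    have := hm ht.le
    have := hg ht.le
    rw [abs_le]; constructor <;> linarith
  set j := ⌊(t + A) / η⌋₊ with hj
  have hj1 : (j : ℝ) * η ≤ t + A := by
    rw [← le_div_iff₀ hη0]; exact Nat.floor_le (by apply div_nonneg <;> linarith)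
  have hj2 : t + A < (j + 1 : ℝ) * η := by
    rw [← div_lt_iff₀ hη0]; exact Nat.lt_floor_add_one _
  rcases le_or_gt t A with ht2 | ht2
  · have hjle : j ≤ ⌊2 * A / η⌋₊ := Nat.floor_mono (by gcongr; linarith)
    have a1 := abs_le.1 (hN j (Finset.mem_range.2 (by omega)))
    have a2 := abs_le.1 (hN (j + 1) (Finset.mem_range.2 (by omega)))
    push_cast at a2
    have b1 := hm (show -A + j * η ≤ t by linarith)
    have b2 := hm (show t ≤ -A + (j + 1) * η by linarith)
    have c1 := cdf_gaussianReal_sub_le (show -A + j * η ≤ t by linarith)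
    have c2 := cdf_gaussianReal_sub_le (show t ≤ -A + (j + 1) * η by linarith)
    rw [abs_le]; constructor <;> linarith
  · set l := ⌊2 * A / η⌋₊ with hl
    have hl1 : (l : ℝ) * η ≤ 2 * A := by
      rw [← le_div_iff₀ hη0]; exact Nat.floor_le (by positivity)
    have hl2 : 2 * A < (l + 1 : ℝ) * η := by
      rw [← div_lt_iff₀ hη0]; exact Nat.lt_floor_add_one _
    rcases le_or_gt (-A + (l + 1) * η) t with h5 | h5
    · have a2 := abs_le.1 (hN (l + 1) (Finset.mem_range.2 (by omega)))
      push_cast at a2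
      have := hm h5
      have := hg (show A ≤ -A + (l + 1) * η by linarith)
      have := hg ht2.le
      rw [abs_le]; constructor <;> linarith
    · have a1 := abs_le.1 (hN l (Finset.mem_range.2 (by omega)))
      have a2 := abs_le.1 (hN (l + 1) (Finset.mem_range.2 (by omega)))
      push_cast at a2
      have b1 := hm (show -A + l * η ≤ t by linarith)
      have b2 := hm h5.le
      have c1 := cdf_gaussianReal_sub_le (show -A + l * η ≤ t by linarith)
      have c2 := cdf_gaussianReal_sub_le h5.le
      rw [abs_le]; constructor <;> linarith

/-- A quantitative form of Lévy's continuity theorem for the normal limit, obtained from the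
qualitative one by contradiction. -/
theorem exists_abs_cdf_sub_le_of_charFun {ε : ℝ} (hε : 0 < ε) : ∃ δ : ℝ, 0 < δ ∧
    ∀ μ : Measure ℝ, IsProbabilityMeasure μ →
      (∀ v : ℝ, ‖charFun μ v - (Real.exp (-v ^ 2 / 2) : ℂ)‖ ≤
        2 * (v ^ 2 + v ^ 4) * √δ + v ^ 4 * δ) →
      ∀ t, |cdf μ t - cdf (gaussianReal 0 1) t| ≤ ε := by
  by_contra! hcon
  choose μ hprob hchar t ht using fun N : ℕ => hcon (1 / (N + 1 : ℝ)) (by positivity)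
  let ν : ℕ → ProbabilityMeasure ℝ := fun N => ⟨μ N, hprob N⟩
  have hlim : Tendsto ν atTop (𝓝 ⟨gaussianReal 0 1, inferInstance⟩) := by
    refine ProbabilityMeasure.tendsto_of_tendsto_charFun fun v => ?_
    have e : charFun (gaussianReal 0 1) v = (Real.exp (-v ^ 2 / 2) : ℂ) := by
      simp [charFun_gaussianReal, neg_div]
    change Tendsto (fun N => charFun (μ N) v) atTop (𝓝 (charFun (gaussianReal 0 1) v))
    rw [e, tendsto_iff_norm_sub_tendsto_zero]
    have h1 : Tendsto (fun N : ℕ => 1 / (N + 1 : ℝ)) atTop (𝓝 0) :=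
      tendsto_one_div_add_atTop_nhds_zero_nat
    have h2 : Tendsto (fun N : ℕ => 2 * (v ^ 2 + v ^ 4) * √(1 / (N + 1 : ℝ)) +
        v ^ 4 * (1 / (N + 1 : ℝ))) atTop (𝓝 0) := by
      have := (((Real.continuous_sqrt.tendsto 0).comp h1).const_mul (2 * (v ^ 2 + v ^ 4))).add
        (h1.const_mul (v ^ 4))
      simpa using this
    exact squeeze_zero (fun _ => norm_nonneg _) (fun N => hchar N v) h2
  obtain ⟨N, hN⟩ := (eventually_abs_cdf_sub_le hlim hε).exists
  exact absurd (hN (t N)) (not_le.2 (ht N))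

end Gaussian

/-- A **Lyapunov central limit theorem**, uniform over all weighted sums of independent identically
distributed variables: the distribution function of a normalized sum is uniformly close to `Φ` as
soon as the sum of the fourth moments is small. -/
theorem exists_abs_real_sum_le_sub_cdf_le {ε : ℝ} (hε : 0 < ε) : ∃ δ : ℝ, 0 < δ ∧
    ∀ (X : Type u) [MeasurableSpace X] (P : Measure X) [IsProbabilityMeasure P]
      (ι : Type) [Fintype ι] (w : ι → ℝ) (f : X → ℝ), Measurable f →
      Integrable (fun x => f x ^ 4) P → ∫ x, f x ∂P = 0 →
      0 < (∑ i, w i ^ 2) * ∫ x, f x ^ 2 ∂P →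
      (∑ i, w i ^ 4) * ∫ x, f x ^ 4 ∂P ≤ δ * ((∑ i, w i ^ 2) * ∫ x, f x ^ 2 ∂P) ^ 2 → ∀ t : ℝ,
      |(Measure.pi fun _ : ι => P).real
          {z | ∑ i, w i * f (z i) ≤ t * √((∑ i, w i ^ 2) * ∫ x, f x ^ 2 ∂P)} -
        cdf (gaussianReal 0 1) t| ≤ ε := by
  obtain ⟨δ, hδ, h⟩ := exists_abs_cdf_sub_le_of_charFun hε
  refine ⟨δ, hδ, fun X _ P _ ι _ w f hf h4 h0 hV hM t => ?_⟩
  set σ2 := (∑ i, w i ^ 2) * ∫ x, f x ^ 2 ∂P with hσ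
  have hs : 0 < √σ2 := Real.sqrt_pos.2 hV
  have hs2 : √σ2 ^ 2 = σ2 := Real.sq_sqrt hV.le
  set w' : ι → ℝ := fun i => w i / √σ2
  have hV' : (∑ i, w' i ^ 2) * ∫ x, f x ^ 2 ∂P = 1 := by
    simp only [w', div_pow, hs2]
    rw [← Finset.sum_div, div_mul_eq_mul_div, ← hσ, div_self hV.ne']
  have hM' : (∑ i, w' i ^ 4) * ∫ x, f x ^ 4 ∂P ≤ δ := by
    have e : √σ2 ^ 4 = σ2 ^ 2 := by rw [show √σ2 ^ 4 = (√σ2 ^ 2) ^ 2 by ring, hs2]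
    simp only [w', div_pow, e]
    rw [← Finset.sum_div, div_mul_eq_mul_div, div_le_iff₀ (by positivity)]
    exact hM
  have hmeas : Measurable fun z : ι → X => ∑ i, w' i * f (z i) := by fun_prop
  have hprob := Measure.isProbabilityMeasure_map (μ := Measure.pi fun _ : ι => P)
    hmeas.aemeasurable
  have := h _ hprob (norm_charFun_sum_sub_exp_le w' hf h4 h0 hV' hδ hM') t
  rw [cdf_eq_real, map_measureReal_apply hmeas measurableSet_Iic] at this
  convert this using 5
  ext z
  simp only [Set.mem_ofPred_eq, Set.mem_preimage, Set.mem_Iic, w']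
  simp_rw [div_mul_eq_mul_div]
  rw [← Finset.sum_div, div_le_iff₀ hs]

/-! ### Two-sample t-statistics -/

/-- `Φ` is uniformly continuous under dilations of its argument by factors close to `1`. -/
theorem exists_cdf_gaussianReal_dilation {ε : ℝ} (hε : 0 < ε) : ∃ η : ℝ, 0 < η ∧ η < 1 ∧
    ∀ t : ℝ, cdf (gaussianReal 0 1) (t + |t| * η) ≤ cdf (gaussianReal 0 1) t + ε ∧
      cdf (gaussianReal 0 1) t - ε ≤ cdf (gaussianReal 0 1) (t - |t| * η) := by
  obtain ⟨A, hA, hA1, hA2⟩ := exists_cdf_gaussianReal_tails hε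
  refine ⟨min (1 / 2) (ε / (2 * A)), by positivity,
    (min_le_left _ _).trans_lt (by norm_num), fun t => ?_⟩
  set η := min (1 / 2) (ε / (2 * A)) with hη
  have hη0 : 0 < η := by positivity
  have hη1 : η ≤ 1 / 2 := min_le_left _ _
  have hη2 : 2 * A * η ≤ ε := by
    have : η ≤ ε / (2 * A) := min_le_right _ _
    rwa [le_div_iff₀ (by positivity), mul_comm] at this
  have hg := monotone_cdf (gaussianReal 0 1)
  have h01 := cdf_le_one (gaussianReal 0 1)
  have h00 := cdf_nonneg (gaussianReal 0 1)
  rcases le_or_gt |t| (2 * A) with h | h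
  · have h1 : |t| * η ≤ ε := (mul_le_mul_of_nonneg_right h hη0.le).trans hη2
    have h2 : 0 ≤ |t| * η := by positivity
    have c1 := cdf_gaussianReal_sub_le (show t ≤ t + |t| * η by linarith)
    have c2 := cdf_gaussianReal_sub_le (show t - |t| * η ≤ t by linarith)
    constructor <;> linarith
  · have h2 : |t| * η ≤ |t| / 2 := by nlinarith [abs_nonneg t]
    rcases le_total 0 t with ht | ht
    · rw [abs_of_nonneg ht] at *
      have := hg (show A ≤ t - t * η by linarith)
      have := hg (show A ≤ t by linarith)
      have := h01 (t + t * η)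
      have := h01 t
      constructor <;> linarith
    · rw [abs_of_nonpos ht] at *
      have := hg (show t + -t * η ≤ -A by linarith)
      have := hg (show t ≤ -A by linarith)
      have := h00 (t - -t * η)
      have := h00 t
      constructor <;> linarith

section Chebyshev

variable {X : Type*} [MeasurableSpace X] {P : Measure X} [IsProbabilityMeasure P]
  {ι : Type*} [Fintype ι]

/-- **Chebyshev's inequality** for a weighted sum of independent centred variables. -/
theorem real_le_abs_sum_le (c : ι → ℝ) {h : X → ℝ} (hh : Measurable h)
    (h2 : Integrable (fun x => h x ^ 2) P) (h0 : ∫ x, h x ∂P = 0) {τ : ℝ} (hτ : 0 < τ) :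
    (Measure.pi fun _ : ι => P).real {u | τ ≤ |∑ i, c i * h (u i)|} ≤
      (∑ i, c i ^ 2) * (∫ x, h x ^ 2 ∂P) / τ ^ 2 := by
  have hL : ∀ i, MemLp (fun x => c i * h x) 2 P := fun i =>
    ((memLp_two_iff_integrable_sq hh.aestronglyMeasurable).2 h2).const_mul (c i)
  have hLi : ∀ i, MemLp (fun u : ι → X => c i * h (u i)) 2 (Measure.pi fun _ : ι => P) :=
    fun i => (hL i).comp_measurePreserving (measurePreserving_eval (fun _ : ι => P) i)
  have hv := variance_sum_pi (μ := fun _ : ι => P) (X := fun i x => c i * h x) hL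
  have hmean : ∀ i, ∫ x, c i * h x ∂P = 0 := fun i => by rw [integral_const_mul, h0, mul_zero]
  have e : (∑ i, fun u : ι → X => c i * h (u i)) = fun u => ∑ i, c i * h (u i) := by
    ext u; simp
  have hv2 : Var[fun u : ι → X => ∑ i, c i * h (u i); Measure.pi fun _ : ι => P]
      = (∑ i, c i ^ 2) * ∫ x, h x ^ 2 ∂P := by
    rw [← e, hv, Finset.sum_mul]
    refine Finset.sum_congr rfl fun i _ => ?_
    rw [variance_of_integral_eq_zero (hL i).aemeasurable (hmean i)]
    simp_rw [mul_pow]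
    rw [integral_const_mul]
  have hS : MemLp (fun u : ι → X => ∑ i, c i * h (u i)) 2 (Measure.pi fun _ : ι => P) :=
    memLp_finsetSum _ fun i _ => hLi i
  have hE : ∫ u : ι → X, ∑ i, c i * h (u i) ∂(Measure.pi fun _ : ι => P) = 0 := by
    rw [integral_finsetSum _ fun i _ => (hLi i).integrable (by norm_num)]
    refine Finset.sum_eq_zero fun i _ => ?_
    rw [integral_comp_eval (μ := fun _ : ι => P) (f := fun x => c i * h x)
      (hL i).aestronglyMeasurable, hmean]
  have := meas_ge_le_variance_div_sq hS hτ
  rw [hE, hv2] at this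
  simp only [sub_zero] at this
  refine ENNReal.toReal_le_of_le_ofReal ?_ this
  have : 0 ≤ ∫ x, h x ^ 2 ∂P := integral_nonneg fun x => sq_nonneg _
  positivity

end Chebyshev

section TwoSample

/-- The weights of a difference of two sample means: `1 / a` on the first sample and `-1 / b` on
the second. -/
def contrast (a b : ℕ) : Fin a ⊕ Fin b → ℝ := Sum.elim (fun _ => (a : ℝ)⁻¹) fun _ => -(b : ℝ)⁻¹

theorem sum_contrast_mul {a b : ℕ} (F : Fin a ⊕ Fin b → ℝ) :
    ∑ i, contrast a b i * F i
      = (a : ℝ)⁻¹ * ∑ i, F (Sum.inl i) - (b : ℝ)⁻¹ * ∑ j, F (Sum.inr j) := by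
  simp [contrast, Fintype.sum_sum_type, Finset.mul_sum, sub_eq_add_neg]

theorem sum_contrast_sq {a b : ℕ} (ha : 0 < a) (hb : 0 < b) :
    ∑ i, contrast a b i ^ 2 = (a : ℝ)⁻¹ + (b : ℝ)⁻¹ := by
  simp [contrast, Fintype.sum_sum_type]
  field_simp

theorem sum_contrast_pow_four {a b : ℕ} (ha : 0 < a) (hb : 0 < b) :
    ∑ i, contrast a b i ^ 4 = (a : ℝ)⁻¹ ^ 3 + (b : ℝ)⁻¹ ^ 3 := by
  simp [contrast, Fintype.sum_sum_type]
  field_simp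

variable {X : Type u} [MeasurableSpace X] {P : Measure X} [IsProbabilityMeasure P] {f : X → ℝ}

theorem empVar_eq {r : ℕ} (hr : 0 < r) (u : Fin r → ℝ) :
    empVar u = (r : ℝ)⁻¹ * ∑ i, u i ^ 2 - empMean u ^ 2 := by
  have hr' : (r : ℝ) ≠ 0 := by positivity
  have e : ∑ i, u i = r * empMean u := by rw [empMean]; field_simp
  rw [empVar]
  simp_rw [sub_sq]
  rw [Finset.sum_add_distrib, Finset.sum_sub_distrib, ← Finset.sum_mul, ← Finset.mul_sum, e]
  simp
  field_simp
  ring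

/-- The empirical variance of a subsample `e : Fin r ↪ ι` concentrates around the variance. -/
theorem real_empVar_le {ι : Type*} [Fintype ι] {r : ℕ} (hr : 0 < r) (e : Fin r ↪ ι)
    (hf : Measurable f) (h4 : Integrable (fun x => f x ^ 4) P) (h0 : ∫ x, f x ∂P = 0)
    (hV : 0 < ∫ x, f x ^ 2 ∂P) {δ : ℝ}
    (hM : ∫ x, f x ^ 4 ∂P ≤ δ * (r * (∫ x, f x ^ 2 ∂P) ^ 2)) {η : ℝ} (hη : 0 < η) (hη1 : η ≤ 1) :
    (Measure.pi fun _ : ι => P).real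
        {u | η * ∫ x, f x ^ 2 ∂P < |empVar (fun i => f (u (e i))) - ∫ x, f x ^ 2 ∂P|} ≤
      6 * δ / η ^ 2 := by
  classical
  have h2 := integrable_pow_of_integrable_pow_four hf h4 (p := 2) (by norm_num)
  have hVM := sq_integral_sq_le hf h4
  set V := ∫ x, f x ^ 2 ∂P with hVdef
  set M := ∫ x, f x ^ 4 ∂P with hMdef
  have hr' : (0 : ℝ) < r := by positivity
  have hδr : 1 ≤ δ * r := by
    have : V ^ 2 * 1 ≤ V ^ 2 * (δ * r) := by nlinarith
    exact le_of_mul_le_mul_left this (by positivity)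
  -- the sample mean over the subsample as a weighted sum over all indices
  set c : ι → ℝ := fun i => if i ∈ Finset.univ.map e then (r : ℝ)⁻¹ else 0 with hc
  have hcsum : ∀ F : ι → ℝ, ∑ i, c i * F i = (r : ℝ)⁻¹ * ∑ j, F (e j) := by
    intro F
    simp only [hc, ite_mul, zero_mul, Finset.sum_ite_mem, Finset.univ_inter, Finset.sum_map,
      Finset.mul_sum]
  have hc2 : ∑ i, c i ^ 2 = (r : ℝ)⁻¹ := by
    have := hcsum c
    simp only [← sq] at this
    rw [this]
    simp [hc]
    field_simp
  have hsub : {u : ι → X | η * V < |empVar (fun i => f (u (e i))) - V|} ⊆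
      {u | η * V / 2 ≤ |∑ i, c i * (f (u i) ^ 2 - V)|} ∪
        {u | √(η * V / 2) ≤ |∑ i, c i * f (u i)|} := by
    intro u hu
    by_contra hcon
    simp only [Set.mem_union, Set.mem_ofPred_eq, not_or, not_le] at hcon hu
    obtain ⟨h1, h3⟩ := hcon
    rw [hcsum (fun i => f (u i) ^ 2 - V), Finset.sum_sub_distrib, mul_sub] at h1
    rw [hcsum (fun i => f (u i)), Real.lt_sqrt (abs_nonneg _), sq_abs] at h3
    simp only [Finset.sum_const, Finset.card_univ, Fintype.card_fin, nsmul_eq_mul] at h1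
    rw [inv_mul_cancel_left₀ hr'.ne'] at h1
    rw [empVar_eq hr, empMean] at hu
    have h5 := abs_lt.1 h1
    have h6 := sq_nonneg ((r : ℝ)⁻¹ * ∑ i, f (u (e i)))
    refine absurd hu (not_lt.2 (abs_le.2 ⟨?_, ?_⟩)) <;> linarith
  have ih2 : ∀ x, (f x ^ 2 - V) ^ 2 = f x ^ 4 - 2 * V * f x ^ 2 + V ^ 2 := fun x => by ring
  have ih : Integrable (fun x => (f x ^ 2 - V) ^ 2) P := by
    simp_rw [ih2]
    exact (h4.sub (h2.const_mul _)).add (integrable_const _)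
  have eh : ∫ x, (f x ^ 2 - V) ^ 2 ∂P = M - V ^ 2 := by
    simp_rw [ih2]
    rw [integral_add (f := fun x => f x ^ 4 - 2 * V * f x ^ 2) (h4.sub (h2.const_mul _))
      (integrable_const _), integral_sub h4 (h2.const_mul _), integral_const_mul]
    simp
    change M - 2 * V * V + V ^ 2 = _
    ring
  have b1 := real_le_abs_sum_le (P := P) c (h := fun x => f x ^ 2 - V) (by fun_prop) ih
    (by rw [integral_sub h2 (integrable_const _)]; simp [← hVdef])
    (show 0 < η * V / 2 by positivity)
  have b2 := real_le_abs_sum_le (P := P) c hf h2 h0 (show 0 < √(η * V / 2) by positivity)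
  rw [eh, hc2] at b1
  rw [hc2, ← hVdef, Real.sq_sqrt (by positivity)] at b2
  have d1 : (r : ℝ)⁻¹ * (M - V ^ 2) / (η * V / 2) ^ 2 ≤ 4 * δ / η ^ 2 := by
    rw [div_le_div_iff₀ (by positivity) (by positivity), inv_mul_eq_div, div_mul_eq_mul_div,
      div_le_iff₀ hr']
    have : (M - V ^ 2) * η ^ 2 ≤ (δ * (r * V ^ 2)) * η ^ 2 := by
      gcongr
      linarith [sq_nonneg V]
    nlinarith
  have d2 : (r : ℝ)⁻¹ * V / (η * V / 2) ≤ 2 * δ / η ^ 2 := by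
    rw [div_le_div_iff₀ (by positivity) (by positivity), inv_mul_eq_div, div_mul_eq_mul_div,
      div_le_iff₀ hr']
    have h7 : V * η ^ 2 ≤ V * η := mul_le_mul_of_nonneg_left (by nlinarith) hV.le
    have h8 : V * η * 1 ≤ V * η * (δ * r) := by gcongr
    nlinarith
  calc _ ≤ _ := measureReal_mono hsub
    _ ≤ _ := measureReal_union_le _ _
    _ ≤ 4 * δ / η ^ 2 + 2 * δ / η ^ 2 := add_le_add (b1.trans d1) (b2.trans d2)
    _ = 6 * δ / η ^ 2 := by ring

/-- If `v₁` and `v₂` estimate `V` with relative error `η`, then so does `√(p v₁ + q v₂)` for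
`√((p + q) V)`. -/
theorem exists_sqrt_eq_mul {p q V η v₁ v₂ σ : ℝ} (hp : 0 < p) (hq : 0 < q) (hV : 0 < V)
    (hη1 : η < 1) (h₁ : |v₁ - V| ≤ η * V) (h₂ : |v₂ - V| ≤ η * V) (hσ : 0 < σ)
    (hσ2 : σ ^ 2 = (p + q) * V) :
    ∃ R, 0 < R ∧ |R - 1| ≤ η ∧ √(p * v₁ + q * v₂) = R * σ := by
  have u1 := abs_le.1 h₁
  have u2 := abs_le.1 h₂
  have hη : 0 ≤ η := by
    by_contra! h
    have := abs_nonneg (v₁ - V)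
    nlinarith
  set s := p * v₁ + q * v₂ with hs
  have p1 := mul_le_mul_of_nonneg_left u1.1 hp.le
  have p2 := mul_le_mul_of_nonneg_left u1.2 hp.le
  have q1 := mul_le_mul_of_nonneg_left u2.1 hq.le
  have q2 := mul_le_mul_of_nonneg_left u2.2 hq.le
  have hlow : (1 - η) * σ ^ 2 ≤ s := by rw [hσ2]; linarith
  have hup : s ≤ (1 + η) * σ ^ 2 := by rw [hσ2]; linarith
  have hs0 : 0 < s := lt_of_lt_of_le (mul_pos (by linarith) (by positivity)) hlow
  have hr0 : 0 < √s := Real.sqrt_pos.2 hs0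
  refine ⟨√s / σ, by positivity, abs_le.2 ⟨?_, ?_⟩, by rw [div_mul_cancel₀ _ hσ.ne']⟩
  · have : 1 - η ≤ √s / σ := by
      rw [le_div_iff₀ hσ]
      refine Real.le_sqrt_of_sq_le (le_trans ?_ hlow)
      rw [mul_pow]
      exact mul_le_mul_of_nonneg_right (by nlinarith) (sq_nonneg σ)
    linarith
  · have : √s / σ ≤ 1 + η := by
      rw [div_le_iff₀ hσ, Real.sqrt_le_left (by positivity)]
      refine hup.trans ?_
      rw [mul_pow]
      exact mul_le_mul_of_nonneg_right (by nlinarith) (sq_nonneg σ)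
    linarith

/-- Asymptotic normality, with uniform error, of the **two-sample t-statistic** of a centred
function `f`: the difference of sample means is divided by its estimated standard deviation. -/
theorem exists_abs_real_tStatistic_sub_cdf_le {ε : ℝ} (hε : 0 < ε) : ∃ δ : ℝ, 0 < δ ∧
    ∀ (X : Type u) [MeasurableSpace X] (P : Measure X) [IsProbabilityMeasure P]
      (a b : ℕ) (f : X → ℝ), 0 < a → 0 < b → Measurable f →
      Integrable (fun x => f x ^ 4) P → ∫ x, f x ∂P = 0 → 0 < ∫ x, f x ^ 2 ∂P →
      ∫ x, f x ^ 4 ∂P ≤ δ * (a * (∫ x, f x ^ 2 ∂P) ^ 2) →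
      ∫ x, f x ^ 4 ∂P ≤ δ * (b * (∫ x, f x ^ 2 ∂P) ^ 2) → ∀ t : ℝ,
      |(Measure.pi fun _ : Fin a ⊕ Fin b => P).real
          {u | (∑ i, contrast a b i * f (u i)) /
              √((a : ℝ)⁻¹ * empVar (fun i => f (u (Sum.inl i))) +
                (b : ℝ)⁻¹ * empVar (fun j => f (u (Sum.inr j)))) ≤ t} -
        cdf (gaussianReal 0 1) t| ≤ ε := by
  obtain ⟨δ₁, hδ₁, hclt⟩ := exists_abs_real_sum_le_sub_cdf_le.{u} (show 0 < ε / 3 by positivity)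
  obtain ⟨η, hη, hη1, hdil⟩ := exists_cdf_gaussianReal_dilation (show 0 < ε / 3 by positivity)
  refine ⟨min δ₁ (ε * η ^ 2 / 36), by positivity, ?_⟩
  intro X _ P _ a b f ha hb hf h4 h0 hV hMa hMb t
  set δ := min δ₁ (ε * η ^ 2 / 36) with hδ
  have hδ1 : δ ≤ δ₁ := min_le_left _ _
  have hδ2 : 6 * δ / η ^ 2 ≤ ε / 6 := by
    have : δ ≤ ε * η ^ 2 / 36 := min_le_right _ _
    rw [div_le_iff₀ (by positivity)]
    linarith
  have va := real_empVar_le (ι := Fin a ⊕ Fin b) ha Function.Embedding.inl hf h4 h0 hV hMa hη hη1.le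
  have vb := real_empVar_le (ι := Fin a ⊕ Fin b) hb Function.Embedding.inr hf h4 h0 hV hMb hη hη1.le
  simp only [Function.Embedding.inl_apply, Function.Embedding.inr_apply] at va vb
  set V := ∫ x, f x ^ 2 ∂P with hVdef
  set M := ∫ x, f x ^ 4 ∂P with hMdef
  have ha' : (0 : ℝ) < a := by positivity
  have hb' : (0 : ℝ) < b := by positivity
  have hw := sum_contrast_sq ha hb
  have hσ : 0 < (∑ i, contrast a b i ^ 2) * V := by rw [hw]; positivity
  have hM0 : (∑ i, contrast a b i ^ 4) * M ≤ δ₁ * ((∑ i, contrast a b i ^ 2) * V) ^ 2 := by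
    rw [sum_contrast_pow_four ha hb, hw]
    have k1 : (a : ℝ)⁻¹ ^ 3 * M ≤ (a : ℝ)⁻¹ ^ 2 * (δ₁ * V ^ 2) := by
      have : (a : ℝ)⁻¹ ^ 3 * M ≤ (a : ℝ)⁻¹ ^ 3 * (δ₁ * (a * V ^ 2)) := by
        gcongr; exact hMa.trans (by gcongr)
      refine this.trans_eq ?_
      field_simp
    have k2 : (b : ℝ)⁻¹ ^ 3 * M ≤ (b : ℝ)⁻¹ ^ 2 * (δ₁ * V ^ 2) := by
      have : (b : ℝ)⁻¹ ^ 3 * M ≤ (b : ℝ)⁻¹ ^ 3 * (δ₁ * (b * V ^ 2)) := by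
        gcongr; exact hMb.trans (by gcongr)
      refine this.trans_eq ?_
      field_simp
    have k3 : 0 ≤ 2 * ((a : ℝ)⁻¹ * (b : ℝ)⁻¹) * (δ₁ * V ^ 2) := by positivity
    nlinarith
  have clt := hclt X P (Fin a ⊕ Fin b) (contrast a b) f hf h4 h0 hσ hM0
  set μ := Measure.pi fun _ : Fin a ⊕ Fin b => P with hμ
  set σ := √((∑ i, contrast a b i ^ 2) * V) with hσdef
  have hσ0 : 0 < σ := Real.sqrt_pos.2 hσ
  have hσ2 : σ ^ 2 = ((a : ℝ)⁻¹ + (b : ℝ)⁻¹) * V := by rw [hσdef, Real.sq_sqrt hσ.le, hw]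
  set S : (Fin a ⊕ Fin b → X) → ℝ := fun u => ∑ i, contrast a b i * f (u i) with hS
  set Va : (Fin a ⊕ Fin b → X) → ℝ := fun u => empVar fun i => f (u (Sum.inl i)) with hVa
  set Vb : (Fin a ⊕ Fin b → X) → ℝ := fun u => empVar fun i => f (u (Sum.inr i)) with hVb
  set B : Set (Fin a ⊕ Fin b → X) := {u | η * V < |Va u - V|} ∪ {u | η * V < |Vb u - V|} with hB
  have hBle : μ.real B ≤ ε / 3 := by
    refine (measureReal_union_le _ _).trans ?_
    linarith
  -- off the exceptional set the estimated standard deviation is `R * σ` with `|R - 1| ≤ η`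
  have key : ∀ u, u ∉ B → ∃ R, 0 < R ∧ |R - 1| ≤ η ∧
      √((a : ℝ)⁻¹ * Va u + (b : ℝ)⁻¹ * Vb u) = R * σ := by
    intro u hu
    simp only [hB, Set.mem_union, Set.mem_ofPred_eq, not_or, not_lt] at hu
    exact exists_sqrt_eq_mul (by positivity) (by positivity) hV hη1 hu.1 hu.2 hσ0 hσ2
  have sub1 : {u | S u / √((a : ℝ)⁻¹ * Va u + (b : ℝ)⁻¹ * Vb u) ≤ t} ⊆
      {u | S u ≤ (t + |t| * η) * σ} ∪ B := by
    intro u hu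
    by_cases huB : u ∈ B
    · exact Or.inr huB
    left
    obtain ⟨R, hR, hR1, e⟩ := key u huB
    simp only [Set.mem_ofPred_eq] at hu ⊢
    rw [e, div_le_iff₀ (by positivity), ← mul_assoc] at hu
    refine hu.trans (mul_le_mul_of_nonneg_right ?_ hσ0.le)
    have : t * (R - 1) ≤ |t| * η :=
      (le_abs_self _).trans (by rw [abs_mul]; gcongr)
    linarith
  have sub2 : {u | S u ≤ (t - |t| * η) * σ} ⊆
      {u | S u / √((a : ℝ)⁻¹ * Va u + (b : ℝ)⁻¹ * Vb u) ≤ t} ∪ B := by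
    intro u hu
    by_cases huB : u ∈ B
    · exact Or.inr huB
    left
    obtain ⟨R, hR, hR1, e⟩ := key u huB
    simp only [Set.mem_ofPred_eq] at hu ⊢
    rw [e, div_le_iff₀ (by positivity), ← mul_assoc]
    refine hu.trans (mul_le_mul_of_nonneg_right ?_ hσ0.le)
    have : -(t * (R - 1)) ≤ |t| * η :=
      (neg_le_abs _).trans (by rw [abs_mul]; gcongr)
    linarith
  have m1 := (measureReal_mono (μ := μ) sub1).trans (measureReal_union_le _ _)
  have m2 := (measureReal_mono (μ := μ) sub2).trans (measureReal_union_le _ _)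
  have c1 := abs_le.1 (clt (t + |t| * η))
  have c2 := abs_le.1 (clt (t - |t| * η))
  have d := hdil t
  rw [abs_le]
  constructor <;> linarith

end TwoSample

/-! ### Fourth moments of linear statistics -/

section FourthMoments

variable {Ω : Type*} [MeasurableSpace Ω] {μ : Measure Ω}

theorem memLp_four_iff {f : Ω → ℝ} (hf : Measurable f) :
    MemLp f 4 μ ↔ Integrable (fun x => f x ^ 4) μ := by
  rw [← integrable_norm_rpow_iff hf.aestronglyMeasurable (by norm_num) (by norm_num)]
  refine integrable_congr (ae_of_all _ fun x => ?_)
  have : (4 : ENNReal).toReal = ((4 : ℕ) : ℝ) := by norm_num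
  simp only [this, Real.rpow_natCast, Real.norm_eq_abs]
  exact Even.pow_abs (by decide) _

theorem integrable_sq_mul_sq {f g : Ω → ℝ} (hf : Measurable f) (hg : Measurable g)
    (hf4 : Integrable (fun x => f x ^ 4) μ) (hg4 : Integrable (fun x => g x ^ 4) μ) :
    Integrable (fun x => f x ^ 2 * g x ^ 2) μ := by
  refine (hf4.add hg4).mono' (by fun_prop) (ae_of_all _ fun x => ?_)
  rw [Real.norm_eq_abs, abs_of_nonneg (by positivity)]
  simp only [Pi.add_apply]
  nlinarith [sq_nonneg (f x ^ 2 - g x ^ 2), sq_nonneg (f x ^ 2), sq_nonneg (g x ^ 2)]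

theorem integrable_pow_mul_pow [IsFiniteMeasure μ] {f g : Ω → ℝ} (hf : Measurable f)
    (hg : Measurable g) (hf4 : Integrable (fun x => f x ^ 4) μ)
    (hg4 : Integrable (fun x => g x ^ 4) μ) {i j : ℕ} (hij : i + j ≤ 4) :
    Integrable (fun x => f x ^ i * g x ^ j) μ := by
  refine ((hf4.add hg4).add (integrable_const 1)).mono' (by fun_prop) (ae_of_all _ fun x => ?_)
  rw [Real.norm_eq_abs, abs_mul, abs_pow, abs_pow]
  simp only [Pi.add_apply]
  rw [← Even.pow_abs (show Even 4 by decide) (f x), ← Even.pow_abs (show Even 4 by decide) (g x)]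
  set a := |f x|
  set b := |g x|
  have ha : 0 ≤ a := abs_nonneg _
  have hb : 0 ≤ b := abs_nonneg _
  have h1 : a ^ i * b ^ j ≤ (max a b) ^ (i + j) := by
    rw [pow_add]
    gcongr
    · exact le_max_left _ _
    · exact le_max_right _ _
  have h2 : (max a b) ^ (i + j) ≤ (max a b) ^ 4 + 1 := by
    have h0 : 0 ≤ max a b := le_max_of_le_left ha
    rcases le_total (max a b) 1 with h | h
    · have := pow_le_one₀ h0 h (n := i + j)
      have : 0 ≤ (max a b) ^ 4 := by positivity
      linarith
    · have := pow_le_pow_right₀ h hij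
      linarith
  have h3 : (max a b) ^ 4 ≤ a ^ 4 + b ^ 4 := by
    rcases max_choice a b with h | h <;> rw [h]
    · have : 0 ≤ b ^ 4 := by positivity
      linarith
    · have : 0 ≤ a ^ 4 := by positivity
      linarith
  linarith

theorem integrable_add_pow_four [IsFiniteMeasure μ] {f g : Ω → ℝ} (hf : Measurable f)
    (hg : Measurable g) (hf4 : Integrable (fun x => f x ^ 4) μ)
    (hg4 : Integrable (fun x => g x ^ 4) μ) : Integrable (fun x => (f x + g x) ^ 4) μ :=
  (memLp_four_iff (hf.add hg)).1 (((memLp_four_iff hf).2 hf4).add ((memLp_four_iff hg).2 hg4))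

/-- The **Cauchy–Schwarz inequality** for real integrals. -/
theorem sq_integral_mul_le {f g : Ω → ℝ} (hf2 : Integrable (fun x => f x ^ 2) μ)
    (hg2 : Integrable (fun x => g x ^ 2) μ) (hfg : Integrable (fun x => f x * g x) μ) :
    (∫ x, f x * g x ∂μ) ^ 2 ≤ (∫ x, f x ^ 2 ∂μ) * ∫ x, g x ^ 2 ∂μ := by
  have h : ∀ s : ℝ, 0 ≤ (∫ x, g x ^ 2 ∂μ) * (s * s) + (-2 * ∫ x, f x * g x ∂μ) * s
      + ∫ x, f x ^ 2 ∂μ := by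
    intro s
    have : 0 ≤ ∫ x, (f x ^ 2 - 2 * s * (f x * g x) + s ^ 2 * g x ^ 2) ∂μ :=
      integral_nonneg fun x => by
        have := sq_nonneg (f x - s * g x)
        simp only [Pi.zero_apply]
        nlinarith
    rw [integral_add (f := fun x => f x ^ 2 - 2 * s * (f x * g x)) (hf2.sub (hfg.const_mul _))
      (hg2.const_mul _), integral_sub hf2 (hfg.const_mul _), integral_const_mul,
      integral_const_mul] at this
    linarith
  have := discrim_le_zero h
  rw [discrim] at this
  nlinarith

end FourthMoments

section IndependentSums

variable {Ω : Type*} [MeasurableSpace Ω] {μ : Measure Ω} {S R ξ η : Ω → ℝ}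

theorem integral_pow_mul_pow_mul_of_indepFun (hS : Measurable S) (hR : Measurable R)
    (hξ : Measurable ξ) (hη : Measurable η)
    (h : IndepFun (fun ω => (S ω, R ω)) (fun ω => (ξ ω, η ω)) μ) (i j k l : ℕ) :
    ∫ ω, (S ω ^ i * R ω ^ j) * (ξ ω ^ k * η ω ^ l) ∂μ =
      (∫ ω, S ω ^ i * R ω ^ j ∂μ) * ∫ ω, ξ ω ^ k * η ω ^ l ∂μ := by
  have h' : IndepFun (fun ω => S ω ^ i * R ω ^ j) (fun ω => ξ ω ^ k * η ω ^ l) μ :=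
    h.comp (φ := fun p : ℝ × ℝ => p.1 ^ i * p.2 ^ j) (ψ := fun p : ℝ × ℝ => p.1 ^ k * p.2 ^ l)
      (by fun_prop) (by fun_prop)
  exact h'.integral_fun_mul_eq_mul_integral (by fun_prop) (by fun_prop)

variable [IsProbabilityMeasure μ]

theorem integrable_pow_mul_pow_mul_of_indepFun (hS : Measurable S) (hR : Measurable R)
    (hξ : Measurable ξ) (hη : Measurable η)
    (h : IndepFun (fun ω => (S ω, R ω)) (fun ω => (ξ ω, η ω)) μ)
    (hS4 : Integrable (fun x => S x ^ 4) μ) (hR4 : Integrable (fun x => R x ^ 4) μ)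
    (hξ4 : Integrable (fun x => ξ x ^ 4) μ) (hη4 : Integrable (fun x => η x ^ 4) μ)
    {i j k l : ℕ} (hij : i + j ≤ 4) (hkl : k + l ≤ 4) :
    Integrable (fun ω => (S ω ^ i * R ω ^ j) * (ξ ω ^ k * η ω ^ l)) μ := by
  have h' : IndepFun (fun ω => S ω ^ i * R ω ^ j) (fun ω => ξ ω ^ k * η ω ^ l) μ :=
    h.comp (φ := fun p : ℝ × ℝ => p.1 ^ i * p.2 ^ j) (ψ := fun p : ℝ × ℝ => p.1 ^ k * p.2 ^ l)
      (by fun_prop) (by fun_prop)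
  exact h'.integrable_mul (integrable_pow_mul_pow hS hR hS4 hR4 hij)
    (integrable_pow_mul_pow hξ hη hξ4 hη4 hkl)

theorem integral_add_mul_add_of_indepFun (hS : Measurable S) (hR : Measurable R)
    (hξ : Measurable ξ) (hη : Measurable η)
    (h : IndepFun (fun ω => (S ω, R ω)) (fun ω => (ξ ω, η ω)) μ)
    (hS4 : Integrable (fun x => S x ^ 4) μ) (hR4 : Integrable (fun x => R x ^ 4) μ)
    (hξ4 : Integrable (fun x => ξ x ^ 4) μ) (hη4 : Integrable (fun x => η x ^ 4) μ)
    (hξ0 : ∫ ω, ξ ω ∂μ = 0) (hη0 : ∫ ω, η ω ∂μ = 0) :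
    ∫ ω, (S ω + ξ ω) * (R ω + η ω) ∂μ = ∫ ω, S ω * R ω ∂μ + ∫ ω, ξ ω * η ω ∂μ := by
  have I : ∀ i j k l : ℕ, i + j ≤ 4 → k + l ≤ 4 →
      Integrable (fun ω => (S ω ^ i * R ω ^ j) * (ξ ω ^ k * η ω ^ l)) μ := fun i j k l hij hkl =>
    integrable_pow_mul_pow_mul_of_indepFun hS hR hξ hη h hS4 hR4 hξ4 hη4 hij hkl
  have E := integral_pow_mul_pow_mul_of_indepFun hS hR hξ hη h
  -- the exponents of `S`, `R`, `ξ`, `η` in the four monomials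
  set ex : Fin 4 → ℕ × ℕ × ℕ × ℕ := ![(1, 1, 0, 0), (1, 0, 0, 1), (0, 1, 1, 0), (0, 0, 1, 1)]
    with hex
  have e : ∀ ω, (S ω + ξ ω) * (R ω + η ω) = ∑ t,
      (S ω ^ (ex t).1 * R ω ^ (ex t).2.1) * (ξ ω ^ (ex t).2.2.1 * η ω ^ (ex t).2.2.2) := by
    intro ω
    simp [hex, Fin.sum_univ_succ]
    ring
  simp_rw [e]
  rw [integral_finsetSum _ fun t _ => I _ _ _ _ (by fin_cases t <;> simp [hex])
    (by fin_cases t <;> simp [hex])]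
  simp_rw [E]
  simp [hex, Fin.sum_univ_succ, hξ0, hη0]

/-- In the expansion of `(S + ξ)² (R + η)²` into nine monomials, those of odd degree in `(ξ, η)`
vanish in expectation. -/
theorem integral_add_sq_mul_add_sq_of_indepFun (hS : Measurable S) (hR : Measurable R)
    (hξ : Measurable ξ) (hη : Measurable η)
    (h : IndepFun (fun ω => (S ω, R ω)) (fun ω => (ξ ω, η ω)) μ)
    (hS4 : Integrable (fun x => S x ^ 4) μ) (hR4 : Integrable (fun x => R x ^ 4) μ)
    (hξ4 : Integrable (fun x => ξ x ^ 4) μ) (hη4 : Integrable (fun x => η x ^ 4) μ)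
    (hS0 : ∫ ω, S ω ∂μ = 0) (hR0 : ∫ ω, R ω ∂μ = 0)
    (hξ0 : ∫ ω, ξ ω ∂μ = 0) (hη0 : ∫ ω, η ω ∂μ = 0) :
    ∫ ω, (S ω + ξ ω) ^ 2 * (R ω + η ω) ^ 2 ∂μ = ∫ ω, S ω ^ 2 * R ω ^ 2 ∂μ
      + (∫ ω, S ω ^ 2 ∂μ) * (∫ ω, η ω ^ 2 ∂μ) + (∫ ω, R ω ^ 2 ∂μ) * (∫ ω, ξ ω ^ 2 ∂μ)
      + 4 * ((∫ ω, S ω * R ω ∂μ) * ∫ ω, ξ ω * η ω ∂μ) + ∫ ω, ξ ω ^ 2 * η ω ^ 2 ∂μ := by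
  have I : ∀ i j k l : ℕ, i + j ≤ 4 → k + l ≤ 4 → ∀ c : ℝ,
      Integrable (fun ω => c * ((S ω ^ i * R ω ^ j) * (ξ ω ^ k * η ω ^ l))) μ :=
    fun i j k l hij hkl c =>
    (integrable_pow_mul_pow_mul_of_indepFun hS hR hξ hη h hS4 hR4 hξ4 hη4 hij hkl).const_mul c
  have E := integral_pow_mul_pow_mul_of_indepFun hS hR hξ hη h
  -- the exponents of `S`, `R`, `ξ`, `η` and the coefficient of the nine monomials
  set ex : Fin 9 → ℕ × ℕ × ℕ × ℕ × ℝ := ![(2, 2, 0, 0, 1), (2, 1, 0, 1, 2), (2, 0, 0, 2, 1),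
    (1, 2, 1, 0, 2), (1, 1, 1, 1, 4), (1, 0, 1, 2, 2), (0, 2, 2, 0, 1), (0, 1, 2, 1, 2),
    (0, 0, 2, 2, 1)] with hex
  have e : ∀ ω, (S ω + ξ ω) ^ 2 * (R ω + η ω) ^ 2 = ∑ t, (ex t).2.2.2.2 *
      ((S ω ^ (ex t).1 * R ω ^ (ex t).2.1) * (ξ ω ^ (ex t).2.2.1 * η ω ^ (ex t).2.2.2.1)) := by
    intro ω
    simp [hex, Fin.sum_univ_succ]
    ring
  simp_rw [e]
  rw [integral_finsetSum _ fun t _ => I _ _ _ _ (by fin_cases t <;> simp [hex])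
    (by fin_cases t <;> simp [hex]) _]
  simp_rw [integral_const_mul, E]
  simp [hex, Fin.sum_univ_succ, hξ0, hη0, hS0, hR0]
  ring

end IndependentSums

section WeightedSums

variable {X : Type*} [MeasurableSpace X] {P : Measure X} [IsProbabilityMeasure P]
  {ι : Type*} [Fintype ι] {f g : X → ℝ}

theorem integrable_comp_eval_pow_four (c : ℝ) (i : ι)
    (hf4 : Integrable (fun x => f x ^ 4) P) :
    Integrable (fun u : ι → X => (c * f (u i)) ^ 4) (Measure.pi fun _ : ι => P) := by
  simp_rw [mul_pow]
  exact (integrable_comp_eval (μ := fun _ : ι => P) (i := i) hf4).const_mul _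

/-- Moments up to order four of partial sums of two linear statistics, in the form of a joint
induction hypothesis. -/
theorem moments_sum_of_centered (w : ι → ℝ) (hf : Measurable f) (hg : Measurable g)
    (hf4 : Integrable (fun x => f x ^ 4) P) (hg4 : Integrable (fun x => g x ^ 4) P)
    (hf0 : ∫ x, f x ∂P = 0) (hg0 : ∫ x, g x ∂P = 0) (s : Finset ι) :
    Integrable (fun u : ι → X => (∑ i ∈ s, w i * f (u i)) ^ 4) (Measure.pi fun _ : ι => P) ∧
    Integrable (fun u : ι → X => (∑ i ∈ s, w i * g (u i)) ^ 4) (Measure.pi fun _ : ι => P) ∧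
    ∫ u : ι → X, (∑ i ∈ s, w i * f (u i)) ∂(Measure.pi fun _ : ι => P) = 0 ∧
    ∫ u : ι → X, (∑ i ∈ s, w i * g (u i)) ∂(Measure.pi fun _ : ι => P) = 0 ∧
    ∫ u : ι → X, (∑ i ∈ s, w i * f (u i)) * (∑ i ∈ s, w i * f (u i))
      ∂(Measure.pi fun _ : ι => P) = (∑ i ∈ s, w i ^ 2) * ∫ x, f x ^ 2 ∂P ∧
    ∫ u : ι → X, (∑ i ∈ s, w i * g (u i)) * (∑ i ∈ s, w i * g (u i))
      ∂(Measure.pi fun _ : ι => P) = (∑ i ∈ s, w i ^ 2) * ∫ x, g x ^ 2 ∂P ∧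
    ∫ u : ι → X, (∑ i ∈ s, w i * f (u i)) * (∑ i ∈ s, w i * g (u i))
      ∂(Measure.pi fun _ : ι => P) = (∑ i ∈ s, w i ^ 2) * ∫ x, f x * g x ∂P ∧
    ∫ u : ι → X, (∑ i ∈ s, w i * f (u i)) ^ 2 * (∑ i ∈ s, w i * g (u i)) ^ 2
      ∂(Measure.pi fun _ : ι => P) ≤ (∑ i ∈ s, w i ^ 4) * ∫ x, f x ^ 2 * g x ^ 2 ∂P +
        (∑ i ∈ s, w i ^ 2) ^ 2 * ((∫ x, f x ^ 2 ∂P) * (∫ x, g x ^ 2 ∂P) +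
          2 * (∫ x, f x * g x ∂P) ^ 2) := by
  classical
  induction s using Finset.induction_on with
  | empty => simp
  | insert i s hi ih =>
    obtain ⟨hS4, hR4, hS0, hR0, hSS, hRR, hSR, hQ⟩ := ih
    have hind0 : iIndepFun (fun (i : ι) (u : ι → X) => (w i * f (u i), w i * g (u i)))
        (Measure.pi fun _ : ι => P) :=
      iIndepFun_pi (μ := fun _ : ι => P) (X := fun i x => (w i * f x, w i * g x))
        (fun i => Measurable.aemeasurable (by fun_prop))
    have hind1 := hind0.indepFun_finsetSum_of_notMem (fun i => by fun_prop) hi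
    have hind : IndepFun (fun u : ι → X => (∑ i ∈ s, w i * f (u i), ∑ i ∈ s, w i * g (u i)))
        (fun u => (w i * f (u i), w i * g (u i))) (Measure.pi fun _ : ι => P) := by
      convert hind1 using 1
      ext u <;> simp [Prod.fst_sum, Prod.snd_sum]
    have hindf := hind.comp (φ := fun p : ℝ × ℝ => (p.1, p.1)) (ψ := fun p : ℝ × ℝ => (p.1, p.1))
      (by fun_prop) (by fun_prop)
    have hindg := hind.comp (φ := fun p : ℝ × ℝ => (p.2, p.2)) (ψ := fun p : ℝ × ℝ => (p.2, p.2))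
      (by fun_prop) (by fun_prop)
    have mS : Measurable fun u : ι → X => ∑ i ∈ s, w i * f (u i) := by fun_prop
    have mR : Measurable fun u : ι → X => ∑ i ∈ s, w i * g (u i) := by fun_prop
    have mξ : Measurable fun u : ι → X => w i * f (u i) := by fun_prop
    have mη : Measurable fun u : ι → X => w i * g (u i) := by fun_prop
    have hξ4 := integrable_comp_eval_pow_four (w i) i hf4
    have hη4 := integrable_comp_eval_pow_four (w i) i hg4
    have ev : ∀ F : X → ℝ, Measurable F → ∫ u : ι → X, F (u i) ∂(Measure.pi fun _ : ι => P)
        = ∫ x, F x ∂P := fun F hF =>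
      integral_comp_eval (μ := fun _ : ι => P) hF.aestronglyMeasurable
    have hξ0 : ∫ u : ι → X, w i * f (u i) ∂(Measure.pi fun _ : ι => P) = 0 := by
      rw [integral_const_mul, ev f hf, hf0, mul_zero]
    have hη0 : ∫ u : ι → X, w i * g (u i) ∂(Measure.pi fun _ : ι => P) = 0 := by
      rw [integral_const_mul, ev g hg, hg0, mul_zero]
    have eξξ : ∫ u : ι → X, w i * f (u i) * (w i * f (u i)) ∂(Measure.pi fun _ : ι => P)
        = w i ^ 2 * ∫ x, f x ^ 2 ∂P := by
      rw [ev (fun x => w i * f x * (w i * f x)) (by fun_prop), ← integral_const_mul]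
      congr 1; ext x; ring
    have eηη : ∫ u : ι → X, w i * g (u i) * (w i * g (u i)) ∂(Measure.pi fun _ : ι => P)
        = w i ^ 2 * ∫ x, g x ^ 2 ∂P := by
      rw [ev (fun x => w i * g x * (w i * g x)) (by fun_prop), ← integral_const_mul]
      congr 1; ext x; ring
    have eξη : ∫ u : ι → X, w i * f (u i) * (w i * g (u i)) ∂(Measure.pi fun _ : ι => P)
        = w i ^ 2 * ∫ x, f x * g x ∂P := by
      rw [ev (fun x => w i * f x * (w i * g x)) (by fun_prop), ← integral_const_mul]
      congr 1; ext x; ring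
    have e22 : ∫ u : ι → X, (w i * f (u i)) ^ 2 * (w i * g (u i)) ^ 2
        ∂(Measure.pi fun _ : ι => P) = w i ^ 4 * ∫ x, f x ^ 2 * g x ^ 2 ∂P := by
      rw [ev (fun x => (w i * f x) ^ 2 * (w i * g x) ^ 2) (by fun_prop), ← integral_const_mul]
      congr 1; ext x; ring
    simp_rw [Finset.sum_insert hi, add_comm (w i * f _), add_comm (w i * g _)]
    refine ⟨integrable_add_pow_four mS mξ hS4 hξ4, integrable_add_pow_four mR mη hR4 hη4, ?_, ?_,
      ?_, ?_, ?_, ?_⟩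
    · rw [integral_add (integrable_of_integrable_pow_four mS hS4)
        (integrable_of_integrable_pow_four mξ hξ4), hS0, hξ0, add_zero]
    · rw [integral_add (integrable_of_integrable_pow_four mR hR4)
        (integrable_of_integrable_pow_four mη hη4), hR0, hη0, add_zero]
    · rw [integral_add_mul_add_of_indepFun mS mS mξ mξ hindf hS4 hS4 hξ4 hξ4 hξ0 hξ0, hSS, eξξ]
      ring
    · rw [integral_add_mul_add_of_indepFun mR mR mη mη hindg hR4 hR4 hη4 hη4 hη0 hη0, hRR, eηη]
      ring
    · rw [integral_add_mul_add_of_indepFun mS mR mξ mη hind hS4 hR4 hξ4 hη4 hξ0 hη0, hSR, eξη]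
      ring
    · rw [integral_add_sq_mul_add_sq_of_indepFun mS mR mξ mη hind hS4 hR4 hξ4 hη4 hS0 hR0 hξ0 hη0,
        e22]
      simp only [sq (∑ i ∈ s, w i * f _), sq (∑ i ∈ s, w i * g _), sq (w i * f _),
        sq (w i * g _)] at hQ ⊢
      rw [hSS, hRR, hSR, eξξ, eηη, eξη]
      set a := ∫ x, f x ^ 2 ∂P with ha
      set b := ∫ x, g x ^ 2 ∂P with hb
      have ha0 : 0 ≤ a := integral_nonneg fun x => sq_nonneg _
      have hb0 : 0 ≤ b := integral_nonneg fun x => sq_nonneg _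
      set c := ∫ x, f x * g x ∂P
      have hw : 0 ≤ (w i ^ 2) ^ 2 * (a * b + 2 * c ^ 2) := by positivity
      linarith

/-- The mixed fourth moment of two linear statistics `∑ wᵢ f(uᵢ)` and `∑ wᵢ g(uᵢ)` is, up to the
diagonal term, what it would be for jointly Gaussian variables. -/
theorem integral_sum_sq_mul_sum_sq_le (w : ι → ℝ) (hf : Measurable f) (hg : Measurable g)
    (hf4 : Integrable (fun x => f x ^ 4) P) (hg4 : Integrable (fun x => g x ^ 4) P)
    (hf0 : ∫ x, f x ∂P = 0) (hg0 : ∫ x, g x ∂P = 0) :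
    ∫ u : ι → X, (∑ i, w i * f (u i)) ^ 2 * (∑ i, w i * g (u i)) ^ 2
      ∂(Measure.pi fun _ : ι => P) ≤ (∑ i, w i ^ 4) * ∫ x, f x ^ 2 * g x ^ 2 ∂P +
        (∑ i, w i ^ 2) ^ 2 * ((∫ x, f x ^ 2 ∂P) * (∫ x, g x ^ 2 ∂P) +
          2 * (∫ x, f x * g x ∂P) ^ 2) :=
  (moments_sum_of_centered w hf hg hf4 hg4 hf0 hg0 Finset.univ).2.2.2.2.2.2.2

theorem integral_sum_sq (w : ι → ℝ) (hf : Measurable f)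
    (hf4 : Integrable (fun x => f x ^ 4) P) (hf0 : ∫ x, f x ∂P = 0) :
    ∫ u : ι → X, (∑ i, w i * f (u i)) ^ 2 ∂(Measure.pi fun _ : ι => P) =
      (∑ i, w i ^ 2) * ∫ x, f x ^ 2 ∂P := by
  simp_rw [sq (∑ i, w i * f _)]
  exact (moments_sum_of_centered w hf hf hf4 hf4 hf0 hf0 Finset.univ).2.2.2.2.1

end WeightedSums

/-! ### Degenerate kernels -/

/-- A symmetric kernel with finite fourth moment which is degenerate with respect to `P`, that is,
centred in each variable. -/
structure IsDegenerate {X : Type*} [MeasurableSpace X] (K : X → X → ℝ) (P : Measure X) : Prop where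
  measurable : Measurable fun z : X × X => K z.1 z.2
  symm : ∀ x y, K x y = K y x
  integral_eq_zero : ∀ x, ∫ y, K x y ∂P = 0
  integrable_pow_four : Integrable (fun z : X × X => K z.1 z.2 ^ 4) (P.prod P)

section Definitions

variable {X : Type*} [MeasurableSpace X] (K : X → X → ℝ) (P : Measure X)

/-- The squared `L²(P)`-norm of the row `K(x, ·)`. -/
def rowSq (x : X) : ℝ := ∫ z, K x z ^ 2 ∂P

/-- The iterated kernel `∫ K(x, z) K(y, z) dP(z)`. -/
def iterKer (x y : X) : ℝ := ∫ z, K x z * K y z ∂P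

variable {ι : Type*} [Fintype ι] (w : ι → ℝ)

/-- The function `x ↦ ∑ wᵢ K(x, uᵢ)` generated by the sample `u`. -/
def linStat (u : ι → X) (x : X) : ℝ := ∑ i, w i * K x (u i)

/-- The second moment of `linStat K w u` under `P`, for a fixed sample `u`. -/
def condSecond (u : ι → X) : ℝ := ∫ x, linStat K w u x ^ 2 ∂P

/-- The fourth moment of `linStat K w u` under `P`, for a fixed sample `u`. -/
def condFourth (u : ι → X) : ℝ := ∫ x, linStat K w u x ^ 4 ∂P

end Definitions

namespace IsDegenerate

variable {X : Type*} [MeasurableSpace X] {K : X → X → ℝ} {P : Measure X}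

theorem measurable_row (h : IsDegenerate K P) (x : X) : Measurable (K x) :=
  h.measurable.comp (by fun_prop : Measurable fun y => (x, y))

theorem measurable_comp (h : IsDegenerate K P) {Ω : Type*} [MeasurableSpace Ω] {a b : Ω → X}
    (ha : Measurable a) (hb : Measurable b) : Measurable fun ω => K (a ω) (b ω) :=
  h.measurable.comp (ha.prodMk hb)

theorem measurable_linStat {ι : Type*} [Fintype ι] (w : ι → ℝ) (h : IsDegenerate K P) :
    Measurable fun p : (ι → X) × X => linStat K w p.1 p.2 := by
  unfold linStat
  exact Finset.measurable_fun_sum _ fun i _ =>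
    (h.measurable_comp (by fun_prop) (by fun_prop)).const_mul (w i)

theorem measurable_linStat_right {ι : Type*} [Fintype ι] (w : ι → ℝ)
    (h : IsDegenerate K P) (u : ι → X) :
    Measurable (linStat K w u) :=
  (h.measurable_linStat w).comp (by fun_prop : Measurable fun x => (u, x))

theorem rowSq_nonneg (x : X) : 0 ≤ rowSq K P x := integral_nonneg fun _ => sq_nonneg _

variable [IsProbabilityMeasure P]

theorem ae_integrable_row_pow_four (h : IsDegenerate K P) :
    ∀ᵐ x ∂P, Integrable (fun z => K x z ^ 4) P := h.integrable_pow_four.prod_right_ae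

theorem measurable_rowSq (h : IsDegenerate K P) : Measurable (rowSq K P) :=
  ((h.measurable.pow_const 2).stronglyMeasurable.integral_prod_right').measurable

theorem measurable_iterKer (h : IsDegenerate K P) :
    Measurable fun p : X × X => iterKer K P p.1 p.2 := by
  have h1 := h.measurable_comp (Ω := (X × X) × X) (a := fun p => p.1.1) (b := fun p => p.2)
    (by fun_prop) (by fun_prop)
  have h2 := h.measurable_comp (Ω := (X × X) × X) (a := fun p => p.1.2) (b := fun p => p.2)
    (by fun_prop) (by fun_prop)
  exact ((h1.mul h2).stronglyMeasurable.integral_prod_right').measurable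

theorem integrable_rowSq_sq (h : IsDegenerate K P) : Integrable (fun x => rowSq K P x ^ 2) P := by
  refine h.integrable_pow_four.integral_prod_left.mono'
    (h.measurable_rowSq.pow_const 2).aestronglyMeasurable ?_
  filter_upwards [h.ae_integrable_row_pow_four] with x hx
  rw [Real.norm_eq_abs, abs_of_nonneg (sq_nonneg _)]
  exact sq_integral_sq_le (h.measurable_row x) hx

theorem integrable_rowSq (h : IsDegenerate K P) : Integrable (rowSq K P) P :=
  ((memLp_two_iff_integrable_sq h.measurable_rowSq.aestronglyMeasurable).2
    h.integrable_rowSq_sq).integrable (by norm_num)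

theorem integrable_sq (h : IsDegenerate K P) :
    Integrable (fun z : X × X => K z.1 z.2 ^ 2) (P.prod P) :=
  integrable_pow_of_integrable_pow_four h.measurable h.integrable_pow_four (by norm_num)

theorem integral_rowSq (h : IsDegenerate K P) : ∫ x, rowSq K P x ∂P = pairMoment K P 2 :=
  (integral_prod _ h.integrable_sq).symm

theorem integral_row_pow_four (h : IsDegenerate K P) :
    ∫ x, ∫ z, K x z ^ 4 ∂P ∂P = pairMoment K P 4 :=
  (integral_prod _ h.integrable_pow_four).symm

theorem integrable_sq_mul_sq_prod (h : IsDegenerate K P) :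
    Integrable (fun p : (X × X) × X => K p.1.1 p.2 ^ 2 * K p.1.2 p.2 ^ 2)
      ((P.prod P).prod P) := by
  have mp1 : MeasurePreserving (Prod.map Prod.fst id : (X × X) × X → X × X)
      ((P.prod P).prod P) (P.prod P) :=
    measurePreserving_fst.prod (MeasurePreserving.id P)
  have mp2 : MeasurePreserving (Prod.map Prod.snd id : (X × X) × X → X × X)
      ((P.prod P).prod P) (P.prod P) :=
    measurePreserving_snd.prod (MeasurePreserving.id P)
  exact integrable_sq_mul_sq (f := fun p : (X × X) × X => K p.1.1 p.2)
    (g := fun p : (X × X) × X => K p.1.2 p.2)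
    (h.measurable_comp (by fun_prop) (by fun_prop)) (h.measurable_comp (by fun_prop) (by fun_prop))
    (mp1.integrable_comp_of_integrable h.integrable_pow_four)
    (mp2.integrable_comp_of_integrable h.integrable_pow_four)

theorem integral_sq_mul_sq_prod (h : IsDegenerate K P) :
    ∫ p : (X × X) × X, K p.1.1 p.2 ^ 2 * K p.1.2 p.2 ^ 2 ∂((P.prod P).prod P) =
      ∫ x, rowSq K P x ^ 2 ∂P := by
  rw [integral_prod_symm _ h.integrable_sq_mul_sq_prod]
  congr 1
  ext z
  rw [integral_prod_mul (fun x => K x z ^ 2) (fun x => K x z ^ 2), rowSq, sq]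
  simp_rw [h.symm z]

theorem integral_rowSq_sq (h : IsDegenerate K P) :
    ∫ x, rowSq K P x ^ 2 ∂P = tripleMoment K P := by
  rw [← h.integral_sq_mul_sq_prod, tripleMoment,
    ← (measurePreserving_prodAssoc P P P).integral_comp']
  rfl

theorem iterKer_sq_le (h : IsDegenerate K P) {x y : X} (hx : Integrable (fun z => K x z ^ 4) P)
    (hy : Integrable (fun z => K y z ^ 4) P) :
    iterKer K P x y ^ 2 ≤ rowSq K P x * rowSq K P y := by
  refine sq_integral_mul_le
    (integrable_pow_of_integrable_pow_four (h.measurable_row x) hx (by norm_num))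
    (integrable_pow_of_integrable_pow_four (h.measurable_row y) hy (by norm_num)) ?_
  simpa using integrable_pow_mul_pow (h.measurable_row x) (h.measurable_row y) hx hy
    (i := 1) (j := 1) (by norm_num)

theorem ae_prod_integrable_row_pow_four (h : IsDegenerate K P) :
    ∀ᵐ p ∂(P.prod P), Integrable (fun z => K p.1 z ^ 4) P ∧ Integrable (fun z => K p.2 z ^ 4) P :=
  (measurePreserving_fst.quasiMeasurePreserving.ae h.ae_integrable_row_pow_four).and
    (measurePreserving_snd.quasiMeasurePreserving.ae h.ae_integrable_row_pow_four)

theorem integrable_iterKer_sq (h : IsDegenerate K P) :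
    Integrable (fun p : X × X => iterKer K P p.1 p.2 ^ 2) (P.prod P) := by
  refine (h.integrable_rowSq.mul_prod h.integrable_rowSq).mono'
    (h.measurable_iterKer.pow_const 2).aestronglyMeasurable ?_
  filter_upwards [h.ae_prod_integrable_row_pow_four] with p hp
  rw [Real.norm_eq_abs, abs_of_nonneg (sq_nonneg _)]
  exact h.iterKer_sq_le hp.1 hp.2

section LinStat

variable {ι : Type*} [Fintype ι] (w : ι → ℝ)

theorem measurable_condSecond (h : IsDegenerate K P) : Measurable (condSecond K P w) :=
  (((h.measurable_linStat w).pow_const 2).stronglyMeasurable.integral_prod_right').measurable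

theorem integrable_linStat_pow_four (h : IsDegenerate K P) :
    Integrable (fun p : (ι → X) × X => linStat K w p.1 p.2 ^ 4)
      ((Measure.pi fun _ : ι => P).prod P) := by
  refine (memLp_four_iff (h.measurable_linStat w)).1 ?_
  unfold linStat
  refine memLp_finsetSum _ fun i _ => MemLp.const_mul ?_ (w i)
  have mp : MeasurePreserving (Prod.map (Function.eval i) id : (ι → X) × X → X × X)
      ((Measure.pi fun _ : ι => P).prod P) (P.prod P) :=
    (measurePreserving_eval (fun _ : ι => P) i).prod (MeasurePreserving.id P)
  refine (memLp_four_iff (h.measurable_comp (by fun_prop) (by fun_prop))).2 ?_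
  have := mp.integrable_comp_of_integrable h.integrable_pow_four
  refine this.congr (ae_of_all _ fun p => ?_)
  simp [h.symm p.2]

theorem integrable_condFourth (h : IsDegenerate K P) :
    Integrable (condFourth K P w) (Measure.pi fun _ : ι => P) :=
  (h.integrable_linStat_pow_four w).integral_prod_left

theorem integrable_condSecond_sq (h : IsDegenerate K P) :
    Integrable (fun u => condSecond K P w u ^ 2) (Measure.pi fun _ : ι => P) := by
  refine (h.integrable_condFourth w).mono'
    ((h.measurable_condSecond w).pow_const 2).aestronglyMeasurable ?_
  filter_upwards [(h.integrable_linStat_pow_four w).prod_right_ae] with u hu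
  rw [Real.norm_eq_abs, abs_of_nonneg (sq_nonneg _)]
  exact sq_integral_sq_le (h.measurable_linStat_right w u) hu

theorem integral_condSecond (h : IsDegenerate K P) :
    ∫ u, condSecond K P w u ∂(Measure.pi fun _ : ι => P) =
      (∑ i, w i ^ 2) * pairMoment K P 2 := by
  have h2 : Integrable (fun p : (ι → X) × X => linStat K w p.1 p.2 ^ 2)
      ((Measure.pi fun _ : ι => P).prod P) :=
    integrable_pow_of_integrable_pow_four (h.measurable_linStat w)
      (h.integrable_linStat_pow_four w) (by norm_num)
  unfold condSecond
  rw [integral_integral_swap h2, ← h.integral_rowSq, ← integral_const_mul]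
  refine integral_congr_ae ?_
  filter_upwards [h.ae_integrable_row_pow_four] with x hx
  exact integral_sum_sq w (h.measurable_row x) hx (h.integral_eq_zero x)

theorem integral_condFourth_le (h : IsDegenerate K P) :
    ∫ u, condFourth K P w u ∂(Measure.pi fun _ : ι => P) ≤
      (∑ i, w i ^ 4) * pairMoment K P 4 + 3 * (∑ i, w i ^ 2) ^ 2 * tripleMoment K P := by
  have h4 := h.integrable_linStat_pow_four w
  unfold condFourth
  rw [integral_integral_swap h4, ← h.integral_row_pow_four, ← h.integral_rowSq_sq,
    ← integral_const_mul, ← integral_const_mul,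
    ← integral_add (h.integrable_pow_four.integral_prod_left.const_mul _)
      (h.integrable_rowSq_sq.const_mul _)]
  refine integral_mono_ae h4.integral_prod_right
    ((h.integrable_pow_four.integral_prod_left.const_mul _).add
      (h.integrable_rowSq_sq.const_mul _)) ?_
  filter_upwards [h.ae_integrable_row_pow_four] with x hx
  have := integral_sum_sq_mul_sum_sq_le w (h.measurable_row x) (h.measurable_row x) hx hx
    (h.integral_eq_zero x) (h.integral_eq_zero x)
  have e4 : ∀ a : ℝ, a ^ 2 * a ^ 2 = a ^ 4 := fun a => by ring
  have e2 : ∀ a : ℝ, a * a = a ^ 2 := fun a => by ring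
  simp only [e4, e2] at this
  refine this.trans_eq ?_
  simp only [rowSq]
  ring

theorem integral_condSecond_sq_le (h : IsDegenerate K P) :
    ∫ u, condSecond K P w u ^ 2 ∂(Measure.pi fun _ : ι => P) ≤
      (∑ i, w i ^ 4) * tripleMoment K P + (∑ i, w i ^ 2) ^ 2 *
        (pairMoment K P 2 ^ 2 + 2 * ∫ p : X × X, iterKer K P p.1 p.2 ^ 2 ∂(P.prod P)) := by
  have mp1 : MeasurePreserving (Prod.map id Prod.fst : (ι → X) × (X × X) → (ι → X) × X)
      ((Measure.pi fun _ : ι => P).prod (P.prod P)) ((Measure.pi fun _ : ι => P).prod P) :=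
    (MeasurePreserving.id _).prod measurePreserving_fst
  have mp2 : MeasurePreserving (Prod.map id Prod.snd : (ι → X) × (X × X) → (ι → X) × X)
      ((Measure.pi fun _ : ι => P).prod (P.prod P)) ((Measure.pi fun _ : ι => P).prod P) :=
    (MeasurePreserving.id _).prod measurePreserving_snd
  have hI : Integrable (fun q : (ι → X) × (X × X) =>
      linStat K w q.1 q.2.1 ^ 2 * linStat K w q.1 q.2.2 ^ 2)
      ((Measure.pi fun _ : ι => P).prod (P.prod P)) :=
    integrable_sq_mul_sq ((h.measurable_linStat w).comp mp1.measurable)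
      ((h.measurable_linStat w).comp mp2.measurable)
      (mp1.integrable_comp_of_integrable (h.integrable_linStat_pow_four w))
      (mp2.integrable_comp_of_integrable (h.integrable_linStat_pow_four w))
  have e : ∀ u : ι → X, condSecond K P w u ^ 2 =
      ∫ p : X × X, linStat K w u p.1 ^ 2 * linStat K w u p.2 ^ 2 ∂(P.prod P) := fun u => by
    rw [integral_prod_mul (fun x => linStat K w u x ^ 2) (fun x => linStat K w u x ^ 2), sq,
      condSecond]
  have hg : Integrable (fun p : X × X => rowSq K P p.1 * rowSq K P p.2 +
      2 * iterKer K P p.1 p.2 ^ 2) (P.prod P) :=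
    (h.integrable_rowSq.mul_prod h.integrable_rowSq).add (h.integrable_iterKer_sq.const_mul 2)
  simp_rw [e]
  rw [integral_integral_swap hI, ← h.integral_rowSq_sq, ← h.integral_sq_mul_sq_prod,
    integral_prod _ h.integrable_sq_mul_sq_prod, ← h.integral_rowSq, sq (∫ x, rowSq K P x ∂P),
    ← integral_prod_mul, ← integral_const_mul 2,
    ← integral_add (h.integrable_rowSq.mul_prod h.integrable_rowSq)
      (h.integrable_iterKer_sq.const_mul 2), ← integral_const_mul, ← integral_const_mul,
    ← integral_add (h.integrable_sq_mul_sq_prod.integral_prod_left.const_mul _)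
      (hg.const_mul _)]
  refine integral_mono_ae hI.integral_prod_right
    ((h.integrable_sq_mul_sq_prod.integral_prod_left.const_mul _).add (hg.const_mul _)) ?_
  filter_upwards [h.ae_prod_integrable_row_pow_four] with p hp
  exact integral_sum_sq_mul_sum_sq_le w (h.measurable_row p.1) (h.measurable_row p.2) hp.1 hp.2
    (h.integral_eq_zero p.1) (h.integral_eq_zero p.2)

/-- When the iterated kernel has small norm, `condSecond` concentrates around its mean. -/
theorem real_condSecond_le_half (h : IsDegenerate K P)
    (hm : 0 < (∑ i, w i ^ 2) * pairMoment K P 2) :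
    (Measure.pi fun _ : ι => P).real
        {u | condSecond K P w u ≤ (∑ i, w i ^ 2) * pairMoment K P 2 / 2} ≤
      4 * ((∑ i, w i ^ 4) * tripleMoment K P + 2 * (∑ i, w i ^ 2) ^ 2 *
        ∫ p : X × X, iterKer K P p.1 p.2 ^ 2 ∂(P.prod P)) /
          ((∑ i, w i ^ 2) * pairMoment K P 2) ^ 2 := by
  have hL : MemLp (condSecond K P w) 2 (Measure.pi fun _ : ι => P) :=
    (memLp_two_iff_integrable_sq (h.measurable_condSecond w).aestronglyMeasurable).2
      (h.integrable_condSecond_sq w)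
  have hE := h.integral_condSecond w
  have hE2 := h.integral_condSecond_sq_le w
  have hvar := variance_eq_sub hL
  have hcheb := meas_ge_le_variance_div_sq hL (half_pos hm)
  rw [hE] at hvar hcheb
  simp only [Pi.pow_apply] at hvar
  set m := (∑ i, w i ^ 2) * pairMoment K P 2 with hmdef
  set Λ := ∫ p : X × X, iterKer K P p.1 p.2 ^ 2 ∂(P.prod P)
  have hsub : {u | condSecond K P w u ≤ m / 2} ⊆ {u | m / 2 ≤ |condSecond K P w u - m|} := by
    intro u hu
    simp only [Set.mem_ofPred_eq] at hu ⊢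
    rw [abs_sub_comm]
    exact (by linarith : m / 2 ≤ m - condSecond K P w u).trans (le_abs_self _)
  have h1 : (Measure.pi fun _ : ι => P).real {u | m / 2 ≤ |condSecond K P w u - m|} ≤
      Var[condSecond K P w; Measure.pi fun _ : ι => P] / (m / 2) ^ 2 :=
    ENNReal.toReal_le_of_le_ofReal (div_nonneg (variance_nonneg _ _) (sq_nonneg _)) hcheb
  refine (measureReal_mono hsub).trans (h1.trans ?_)
  have hv : Var[condSecond K P w; Measure.pi fun _ : ι => P] ≤
      (∑ i, w i ^ 4) * tripleMoment K P + 2 * (∑ i, w i ^ 2) ^ 2 * Λ := by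
    rw [hvar, hmdef]
    nlinarith
  rw [div_le_div_iff₀ (by positivity) (by positivity)]
  nlinarith [mul_le_mul_of_nonneg_right hv (sq_nonneg m)]

end LinStat

/-- When the iterated kernel does not have small norm, one of its rows has a large second
moment relative to `rowSq`. -/
theorem exists_lt_integral_iterKer_sq (h : IsDegenerate K P) {ρ : ℝ}
    (hΛ : ρ * pairMoment K P 2 ^ 2 < ∫ p : X × X, iterKer K P p.1 p.2 ^ 2 ∂(P.prod P)) :
    ∃ y, Integrable (fun z => K y z ^ 4) P ∧
      ρ * pairMoment K P 2 * rowSq K P y < ∫ x, iterKer K P x y ^ 2 ∂P := by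
  by_contra! hcon
  refine absurd hΛ (not_lt.2 ?_)
  rw [integral_prod_symm _ h.integrable_iterKer_sq, sq (pairMoment K P 2), ← mul_assoc]
  nth_rewrite 2 [← h.integral_rowSq]
  rw [← integral_const_mul]
  refine integral_mono_ae h.integrable_iterKer_sq.integral_prod_right
    (h.integrable_rowSq.const_mul _) ?_
  filter_upwards [h.ae_integrable_row_pow_four] with y hy
  exact hcon y hy

section Row

variable {y : X}

theorem measurable_iterKer_left (h : IsDegenerate K P) :
    Measurable fun x => iterKer K P x y :=
  h.measurable_iterKer.comp (by fun_prop : Measurable fun x => (x, y))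

theorem ae_iterKer_pow_four_le (h : IsDegenerate K P) (hy : Integrable (fun z => K y z ^ 4) P) :
    ∀ᵐ x ∂P, iterKer K P x y ^ 4 ≤ rowSq K P y ^ 2 * rowSq K P x ^ 2 := by
  filter_upwards [h.ae_integrable_row_pow_four] with x hx
  have := pow_le_pow_left₀ (sq_nonneg _) (h.iterKer_sq_le hx hy) 2
  calc iterKer K P x y ^ 4 = (iterKer K P x y ^ 2) ^ 2 := by ring
    _ ≤ _ := this
    _ = _ := by ring

theorem integrable_iterKer_pow_four (h : IsDegenerate K P)
    (hy : Integrable (fun z => K y z ^ 4) P) : Integrable (fun x => iterKer K P x y ^ 4) P := by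
  refine (h.integrable_rowSq_sq.const_mul (rowSq K P y ^ 2)).mono'
    (h.measurable_iterKer_left.pow_const 4).aestronglyMeasurable ?_
  filter_upwards [h.ae_iterKer_pow_four_le hy] with x hx
  rwa [Real.norm_eq_abs, abs_of_nonneg (by positivity)]

theorem integral_iterKer_pow_four_le (h : IsDegenerate K P)
    (hy : Integrable (fun z => K y z ^ 4) P) :
    ∫ x, iterKer K P x y ^ 4 ∂P ≤ tripleMoment K P * rowSq K P y ^ 2 := by
  rw [← h.integral_rowSq_sq, mul_comm, ← integral_const_mul]
  exact integral_mono_ae (h.integrable_iterKer_pow_four hy) (h.integrable_rowSq_sq.const_mul _)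
    (h.ae_iterKer_pow_four_le hy)

theorem integral_iterKer (h : IsDegenerate K P) (hy : Integrable (fun z => K y z ^ 4) P) :
    ∫ x, iterKer K P x y ∂P = 0 := by
  have h2 : Integrable (fun z : X × X => K y z.2 ^ 4) (P.prod P) :=
    measurePreserving_snd.integrable_comp_of_integrable hy
  have hI : Integrable (fun z : X × X => K z.1 z.2 * K y z.2) (P.prod P) := by
    simpa using integrable_pow_mul_pow h.measurable
      (h.measurable_comp (Ω := X × X) (a := fun _ => y) (b := Prod.snd)
        (by fun_prop) (by fun_prop)) h.integrable_pow_four h2 (i := 1) (j := 1) (by norm_num)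
  unfold iterKer
  rw [integral_integral_swap hI]
  simp_rw [integral_mul_const, fun z x => h.symm x z, h.integral_eq_zero]
  simp

theorem sq_sum_iterKer_le (h : IsDegenerate K P) {ι : Type*} [Fintype ι] (w : ι → ℝ) {u : ι → X}
    (hu : ∀ i, Integrable (fun z => K (u i) z ^ 4) P) (hy : Integrable (fun z => K y z ^ 4) P) :
    (∑ i, w i * iterKer K P (u i) y) ^ 2 ≤ condSecond K P w u * rowSq K P y := by
  have hA4 : Integrable (fun x => linStat K w u x ^ 4) P := by
    refine (memLp_four_iff (h.measurable_linStat_right w u)).1 ?_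
    unfold linStat
    refine memLp_finsetSum _ fun i _ => MemLp.const_mul ?_ (w i)
    simp_rw [fun x => h.symm x (u i)]
    exact (memLp_four_iff (h.measurable_row (u i))).2 (hu i)
  have hmix : ∀ i, Integrable (fun x => K (u i) x * K y x) P := fun i => by
    simpa using integrable_pow_mul_pow (h.measurable_row (u i)) (h.measurable_row y) (hu i) hy
      (i := 1) (j := 1) (by norm_num)
  have e : ∑ i, w i * iterKer K P (u i) y = ∫ x, linStat K w u x * K y x ∂P := by
    unfold linStat iterKer
    simp_rw [Finset.sum_mul, ← integral_const_mul]
    rw [← integral_finsetSum _ fun i _ => (hmix i).const_mul (w i)]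
    congr 1
    ext x
    refine Finset.sum_congr rfl fun i _ => ?_
    rw [h.symm x]
    ring
  rw [e]
  refine sq_integral_mul_le
    (integrable_pow_of_integrable_pow_four (h.measurable_linStat_right w u) hA4 (by norm_num))
    (integrable_pow_of_integrable_pow_four (h.measurable_row y) hy (by norm_num)) ?_
  simpa using integrable_pow_mul_pow (h.measurable_linStat_right w u) (h.measurable_row y) hA4 hy
    (i := 1) (j := 1) (by norm_num)

theorem ae_forall_integrable_row_pow_four (h : IsDegenerate K P) {ι : Type*} [Fintype ι] :
    ∀ᵐ u ∂(Measure.pi fun _ : ι => P), ∀ i, Integrable (fun z => K (u i) z ^ 4) P :=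
  ae_all_iff.2 fun i => (measurePreserving_eval (fun _ : ι => P) i).quasiMeasurePreserving.ae
    h.ae_integrable_row_pow_four

end Row

end IsDegenerate

/-! ### Small-ball estimate and regular samples -/

/-- **Small-ball estimate**: `condSecond`, a degenerate quadratic statistic of the sample with mean
`(∑ wᵢ²) 𝔼[K²]`, is unlikely to be much smaller than its mean. -/
theorem exists_real_condSecond_le {ε : ℝ} (hε : 0 < ε) : ∃ δ : ℝ, 0 < δ ∧ ∃ τ : ℝ, 0 < τ ∧
    ∀ (X : Type u) [MeasurableSpace X] (P : Measure X) [IsProbabilityMeasure P] (K : X → X → ℝ),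
      IsDegenerate K P → 0 < pairMoment K P 2 →
      ∀ (ι : Type) [Fintype ι] (w : ι → ℝ), 0 < ∑ i, w i ^ 2 →
      (∑ i, w i ^ 4) * tripleMoment K P ≤ τ * ((∑ i, w i ^ 2) * pairMoment K P 2) ^ 2 →
      (Measure.pi fun _ : ι => P).real
        {u | condSecond K P w u ≤ δ * ((∑ i, w i ^ 2) * pairMoment K P 2)} ≤ ε := by
  obtain ⟨δ₁, hδ₁, hclt⟩ := exists_abs_real_sum_le_sub_cdf_le.{u} (show 0 < ε / 4 by positivity)
  -- `ρ` separates the two cases; in the second one, `s` bounds the normalized linear statistic, and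
  -- an interval of length `3 s` has normal probability at most `ε / 2`
  set ρ := ε / 16 with hρ
  set s := ε / 6 with hs
  have hρ0 : 0 < ρ := by positivity
  have hs0 : 0 < s := by positivity
  refine ⟨min (1 / 2) (ρ * s ^ 2), by positivity, min (ε / 8) (δ₁ * ρ ^ 2), by positivity, ?_⟩
  intro X _ P _ K h hS2 ι _ w hW hτ
  set S2 := pairMoment K P 2 with hS2def
  set W2 := ∑ i, w i ^ 2 with hW2
  set W4 := ∑ i, w i ^ 4 with hW4
  set T := tripleMoment K P with hT
  have hm : 0 < W2 * S2 := by positivity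
  have hW40 : 0 ≤ W4 := Finset.sum_nonneg fun i _ => by positivity
  rcases le_or_gt (∫ p : X × X, iterKer K P p.1 p.2 ^ 2 ∂(P.prod P)) (ρ * S2 ^ 2) with hΛ | hΛ
  · refine (measureReal_mono (s₂ := {u | condSecond K P w u ≤ W2 * S2 / 2}) ?_).trans
      ((h.real_condSecond_le_half w hm).trans ?_)
    · intro u hu
      refine le_trans (Set.mem_ofPred_eq.mp hu : _) ?_
      have := mul_le_mul_of_nonneg_right (min_le_left (1 / 2) (ρ * s ^ 2)) hm.le
      linarith
    · rw [div_le_iff₀ (by positivity)]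
      have h1 : W4 * T ≤ ε / 8 * (W2 * S2) ^ 2 :=
        hτ.trans (mul_le_mul_of_nonneg_right (min_le_left _ _) (sq_nonneg _))
      have h2 := mul_le_mul_of_nonneg_left hΛ (sq_nonneg W2)
      rw [hρ] at h2
      nlinarith
  · obtain ⟨y, hy, hlt⟩ := h.exists_lt_integral_iterKer_sq hΛ
    set f : X → ℝ := fun x => iterKer K P x y with hf
    set V := ∫ x, iterKer K P x y ^ 2 ∂P with hV
    set q := rowSq K P y with hq
    have hq0 : 0 ≤ q := IsDegenerate.rowSq_nonneg y
    have hV0 : 0 < V := lt_of_le_of_lt (by positivity) hlt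
    have h4 := h.integral_iterKer_pow_four_le hy
    have hT4 : W4 * ∫ x, f x ^ 4 ∂P ≤ δ₁ * (W2 * V) ^ 2 := by
      have h1 : W4 * T ≤ δ₁ * ρ ^ 2 * (W2 * S2) ^ 2 :=
        hτ.trans (mul_le_mul_of_nonneg_right (min_le_right _ _) (sq_nonneg _))
      calc W4 * ∫ x, f x ^ 4 ∂P ≤ W4 * (T * q ^ 2) := mul_le_mul_of_nonneg_left h4 hW40
        _ = W4 * T * q ^ 2 := by ring
        _ ≤ δ₁ * ρ ^ 2 * (W2 * S2) ^ 2 * q ^ 2 := mul_le_mul_of_nonneg_right h1 (sq_nonneg _)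
        _ = δ₁ * W2 ^ 2 * (ρ * S2 * q) ^ 2 := by ring
        _ ≤ δ₁ * W2 ^ 2 * V ^ 2 := by gcongr
        _ = _ := by ring
    have hσ : 0 < W2 * V := by positivity
    have clt := hclt X P ι w f h.measurable_iterKer_left (h.integrable_iterKer_pow_four hy)
      (h.integral_iterKer hy) hσ hT4
    change ∀ t, |(Measure.pi fun _ : ι => P).real {z | ∑ i, w i * f (z i) ≤ t * √(W2 * V)} - _| ≤ _
      at clt
    set σ := √(W2 * V) with hσdef
    have hσ0 : 0 < σ := Real.sqrt_pos.2 hσ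
    have hmf : Measurable f := h.measurable_iterKer_left
    have hms : ∀ c, MeasurableSet {u : ι → X | ∑ i, w i * f (u i) ≤ c} := fun c =>
      measurableSet_le (by fun_prop) measurable_const
    -- the Cauchy–Schwarz inequality turns a small value of `condSecond` into a small value of the
    -- linear statistic `∑ wᵢ f(uᵢ)`, which is asymptotically normal
    have hae : ∀ᵐ u ∂(Measure.pi fun _ : ι => P),
        condSecond K P w u ≤ min (1 / 2) (ρ * s ^ 2) * (W2 * S2) →
          u ∈ {u : ι → X | ∑ i, w i * f (u i) ≤ s * σ} \
            {u : ι → X | ∑ i, w i * f (u i) ≤ (-(2 * s)) * σ} := by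
      filter_upwards [h.ae_forall_integrable_row_pow_four (ι := ι)] with u hu hle
      have h1 := h.sq_sum_iterKer_le w hu hy
      have h2 : (∑ i, w i * f (u i)) ^ 2 ≤ (s * σ) ^ 2 := by
        calc (∑ i, w i * f (u i)) ^ 2 ≤ condSecond K P w u * q := h1
          _ ≤ (ρ * s ^ 2 * (W2 * S2)) * q := mul_le_mul_of_nonneg_right
              (hle.trans (mul_le_mul_of_nonneg_right (min_le_right _ _) hm.le)) hq0
          _ = s ^ 2 * W2 * (ρ * S2 * q) := by ring
          _ ≤ s ^ 2 * W2 * V := mul_le_mul_of_nonneg_left hlt.le (by positivity)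
          _ = (s * σ) ^ 2 := by rw [mul_pow, hσdef, Real.sq_sqrt hσ.le]; ring
      have h3 := abs_le.1 (abs_le_of_sq_le_sq h2 (by positivity))
      refine ⟨h3.2, fun hcon => ?_⟩
      have h5 : 0 < s * σ := by positivity
      have h6 : ∑ i, w i * f (u i) ≤ -(2 * s) * σ := hcon
      linarith [h3.1]
    have hdiff := measureReal_sdiff (μ := Measure.pi fun _ : ι => P)
      (s₁ := {u : ι → X | ∑ i, w i * f (u i) ≤ s * σ})
      (s₂ := {u : ι → X | ∑ i, w i * f (u i) ≤ (-(2 * s)) * σ})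
      (fun u hu => le_trans hu (mul_le_mul_of_nonneg_right (by linarith) hσ0.le)) (hms _)
    have hle : (Measure.pi fun _ : ι => P).real
        {u | condSecond K P w u ≤ min (1 / 2) (ρ * s ^ 2) * (W2 * S2)} ≤
        (Measure.pi fun _ : ι => P).real ({u : ι → X | ∑ i, w i * f (u i) ≤ s * σ} \
            {u : ι → X | ∑ i, w i * f (u i) ≤ (-(2 * s)) * σ}) :=
      ENNReal.toReal_mono (measure_ne_top _ _) (measure_mono_ae hae)
    have c1 := abs_le.1 (clt s)
    have c2 := abs_le.1 (clt (-(2 * s)))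
    have c3 := cdf_gaussianReal_sub_le (show -(2 * s) ≤ s by linarith)
    rw [hdiff] at hle
    linarith

/-- The sample `u` is `δ`-regular at sample size `r` if, conditionally on `u`, the function
`linStat K w u` is centred and satisfies a Lyapunov condition with constant `δ * r`. -/
def IsRegularSample {X : Type*} [MeasurableSpace X] (K : X → X → ℝ) (P : Measure X) {ι : Type*}
    [Fintype ι] (w : ι → ℝ) (δ r : ℝ) (u : ι → X) : Prop :=
  Integrable (fun x => linStat K w u x ^ 4) P ∧ ∫ x, linStat K w u x ∂P = 0 ∧
    0 < condSecond K P w u ∧ condFourth K P w u ≤ δ * (r * condSecond K P w u ^ 2)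

theorem IsDegenerate.integral_linStat {X : Type*} [MeasurableSpace X] {K : X → X → ℝ}
    {P : Measure X} [IsProbabilityMeasure P] (h : IsDegenerate K P) {ι : Type*} [Fintype ι]
    (w : ι → ℝ) {u : ι → X} (hu : ∀ i, Integrable (fun z => K (u i) z ^ 4) P) :
    ∫ x, linStat K w u x ∂P = 0 := by
  unfold linStat
  simp_rw [fun i x => h.symm x (u i)]
  rw [integral_finsetSum _ fun i _ =>
    (integrable_of_integrable_pow_four (h.measurable_row (u i)) (hu i)).const_mul (w i)]
  simp [integral_const_mul, h.integral_eq_zero]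

/-- Samples are regular with high probability. -/
theorem exists_real_not_isRegularSample_le {ε δ : ℝ} (hε : 0 < ε) (hδ : 0 < δ) :
    ∃ τ : ℝ, 0 < τ ∧
    ∀ (X : Type u) [MeasurableSpace X] (P : Measure X) [IsProbabilityMeasure P] (K : X → X → ℝ),
      IsDegenerate K P → 0 < pairMoment K P 2 →
      ∀ (ι : Type) [Fintype ι] (w : ι → ℝ), 0 < ∑ i, w i ^ 2 → ∀ r : ℝ, 0 < r →
      (∑ i, w i ^ 4) * tripleMoment K P ≤ τ * ((∑ i, w i ^ 2) * pairMoment K P 2) ^ 2 →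
      (∑ i, w i ^ 4) * pairMoment K P 4 + 3 * (∑ i, w i ^ 2) ^ 2 * tripleMoment K P ≤
        τ * (r * ((∑ i, w i ^ 2) * pairMoment K P 2) ^ 2) →
      (Measure.pi fun _ : ι => P).real {u | ¬ IsRegularSample K P w δ r u} ≤ ε := by
  obtain ⟨δ₀, hδ₀, τ₀, hτ₀, hsmall⟩ := exists_real_condSecond_le.{u} (half_pos hε)
  refine ⟨min τ₀ (ε / 2 * (δ * δ₀ ^ 2)), by positivity, ?_⟩
  intro X _ P _ K h hS2 ι _ w hW r hr h1 h2
  have hm : 0 < (∑ i, w i ^ 2) * pairMoment K P 2 := by positivity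
  have hs := hsmall X P K h hS2 ι w hW
    (h1.trans (mul_le_mul_of_nonneg_right (min_le_left _ _) (sq_nonneg _)))
  have hE := h.integral_condFourth_le w
  set m := (∑ i, w i ^ 2) * pairMoment K P 2 with hmdef
  set c := δ * (r * (δ₀ * m) ^ 2) with hc
  have hc0 : 0 < c := by positivity
  have hmarkov := mul_meas_ge_le_integral_of_nonneg (μ := Measure.pi fun _ : ι => P)
    (f := condFourth K P w) (ae_of_all _ fun u => integral_nonneg fun x => by positivity)
    (h.integrable_condFourth w) c
  have hM : (Measure.pi fun _ : ι => P).real {u | c ≤ condFourth K P w u} ≤ ε / 2 := by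
    refine le_of_mul_le_mul_left ?_ hc0
    refine hmarkov.trans (hE.trans (h2.trans ?_))
    calc _ ≤ ε / 2 * (δ * δ₀ ^ 2) * (r * m ^ 2) :=
          mul_le_mul_of_nonneg_right (min_le_right _ _) (by positivity)
      _ = c * (ε / 2) := by rw [hc]; ring
  have hae : ∀ᵐ u ∂(Measure.pi fun _ : ι => P), ¬ IsRegularSample K P w δ r u →
      u ∈ {u | condSecond K P w u ≤ δ₀ * m} ∪ {u | c ≤ condFourth K P w u} := by
    filter_upwards [h.ae_forall_integrable_row_pow_four (ι := ι),
      (h.integrable_linStat_pow_four w).prod_right_ae] with u hu hu4 hnot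
    by_contra hcon
    simp only [Set.mem_union, Set.mem_ofPred_eq, not_or, not_le] at hcon
    obtain ⟨k1, k2⟩ := hcon
    have k3 : 0 < δ₀ * m := by positivity
    refine hnot ⟨hu4, h.integral_linStat w hu, k3.trans k1, k2.le.trans ?_⟩
    rw [hc]
    gcongr
  calc _ ≤ (Measure.pi fun _ : ι => P).real
        ({u | condSecond K P w u ≤ δ₀ * m} ∪ {u | c ≤ condFourth K P w u}) :=
        ENNReal.toReal_mono (measure_ne_top _ _) (measure_mono_ae hae)
    _ ≤ _ := measureReal_union_le _ _
    _ ≤ ε / 2 + ε / 2 := add_le_add hs hM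
    _ = ε := by ring

/-! ### The studentized statistic as a conditional t-statistic -/

namespace PosDefKernel

theorem inner_feature_feature {X : Type*} {k : PosDefKernel X} (x y : X) :
    inner ℝ (k.feature x) (k.feature y) = k.toFun x y := by
  rw [inner_feature, feature_apply, k.symm]

variable {X : Type*} [MeasurableSpace X] {k : PosDefKernel X} {P : Measure X}

theorem isMeanEmbedding_meanEmbedding (h : ∃ μ, k.IsMeanEmbedding P μ) :
    k.IsMeanEmbedding P (k.meanEmbedding P) := Classical.epsilon_spec h

theorem centered_eq (x y : X) : k.centered P x y = k.toFun x y - k.meanEmbedding P x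
    - k.meanEmbedding P y + inner ℝ (k.meanEmbedding P) (k.meanEmbedding P) := by
  rw [centered, inner_sub_left, inner_sub_right, inner_sub_right, inner_feature_feature,
    inner_feature, real_inner_comm, inner_feature]
  ring

theorem isDegenerate_centered [IsProbabilityMeasure P]
    (hk : Measurable fun z : X × X => k.toFun z.1 z.2)
    (hemb : ∃ μ, k.IsMeanEmbedding P μ)
    (h4 : Integrable (fun z : X × X => k.centered P z.1 z.2 ^ 4) (P.prod P)) :
    IsDegenerate (k.centered P) P where
  measurable := by
    have hμ : Measurable fun x => k.meanEmbedding P x := by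
      have e : (fun x => k.meanEmbedding P x) = fun x => ∫ y, k.toFun x y ∂P := by
        ext x
        rw [← inner_feature, real_inner_comm,
          ((isMeanEmbedding_meanEmbedding hemb) (k.feature x)).2]
        simp_rw [feature_apply]
      rw [e]
      exact (hk.stronglyMeasurable.integral_prod_right').measurable
    simp_rw [centered_eq]
    exact ((hk.sub (hμ.comp measurable_fst)).sub (hμ.comp measurable_snd)).add measurable_const
  symm x y := real_inner_comm _ _
  integral_eq_zero x := by
    obtain ⟨hi, he⟩ := isMeanEmbedding_meanEmbedding hemb (k.feature x - k.meanEmbedding P)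
    have e : ∀ y, k.centered P x y = (k.feature x - k.meanEmbedding P) y
        - inner ℝ (k.feature x - k.meanEmbedding P) (k.meanEmbedding P) := by
      intro y
      rw [centered, inner_sub_right, real_inner_comm, inner_feature]
    simp_rw [e]
    rw [integral_sub hi (integrable_const _), ← he, real_inner_comm]
    simp
  integrable_pow_four := h4

end PosDefKernel

section Algebra

variable {X : Type*} {k : PosDefKernel X} {n m : ℕ}

theorem empVar_add_const {r : ℕ} (hr : 0 < r) (u : Fin r → ℝ) (c : ℝ) :
    empVar (fun i => u i + c) = empVar u := by
  have hr' : (r : ℝ) ≠ 0 := by positivity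
  have e : empMean (fun i => u i + c) = empMean u + c := by
    simp only [empMean, Finset.sum_add_distrib]
    simp
    field_simp
  simp only [empVar, e, add_sub_add_right_eq_sub]

theorem uStat_eq (x : Fin n → X) (y : Fin m → X) (z : X) :
    uStat k x y z = ((n - n / 2 : ℕ) : ℝ)⁻¹ * ∑ i, k.toFun z (secondHalf x i)
      - ((m - m / 2 : ℕ) : ℝ)⁻¹ * ∑ j, k.toFun z (secondHalf y j) := by
  simp [uStat, PosDefKernel.empEmbedding, inner_sub_right, inner_smul_right, inner_sum,
    PosDefKernel.inner_feature_feature]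

theorem xMMDsq_eq (hn : 2 ≤ n) (hm : 2 ≤ m) (x : Fin n → X) (y : Fin m → X) :
    xMMDsq k x y = ((n / 2 : ℕ) : ℝ)⁻¹ * ∑ i, uStat k x y (firstHalf x i)
      - ((m / 2 : ℕ) : ℝ)⁻¹ * ∑ j, uStat k x y (firstHalf y j) := by
  have h1 : ((n / 2 : ℕ) : ℝ) ≠ 0 := by norm_cast; omega
  have h2 : ((m / 2 : ℕ) : ℝ) ≠ 0 := by norm_cast; omega
  have h3 : ((n - n / 2 : ℕ) : ℝ) ≠ 0 := by norm_cast; omega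
  have h4 : ((m - m / 2 : ℕ) : ℝ) ≠ 0 := by norm_cast; omega
  simp only [xMMDsq, uStat_eq, PosDefKernel.hFun, Finset.sum_add_distrib, Finset.sum_sub_distrib,
    Finset.sum_const, Finset.card_univ, Fintype.card_fin, nsmul_eq_mul, ← Finset.mul_sum]
  rw [Finset.sum_comm (f := fun i' j => k.toFun (firstHalf y j) (secondHalf x i'))]
  field_simp
  ring

variable [MeasurableSpace X] {P : Measure X}

theorem uStat_eq_linStat (hn : 2 ≤ n) (hm : 2 ≤ m) (x : Fin n → X) (y : Fin m → X) (z : X) :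
    uStat k x y z = linStat (k.centered P) (contrast (n - n / 2) (m - m / 2))
      (Sum.elim (secondHalf x) (secondHalf y)) z
        + inner ℝ (k.meanEmbedding P) (k.empEmbedding (secondHalf x) -
          k.empEmbedding (secondHalf y)) := by
  have h3 : ((n - n / 2 : ℕ) : ℝ) ≠ 0 := by norm_cast; omega
  have h4 : ((m - m / 2 : ℕ) : ℝ) ≠ 0 := by norm_cast; omega
  rw [linStat, sum_contrast_mul, uStat]
  simp only [Sum.elim_inl, Sum.elim_inr, PosDefKernel.centered, PosDefKernel.empEmbedding,
    inner_sub_right, inner_sub_left, inner_smul_right, inner_sum, Finset.sum_sub_distrib,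
    Finset.sum_const, Finset.card_univ, Fintype.card_fin, nsmul_eq_mul]
  field_simp
  ring

/-- Given the second halves, the studentized statistic is a two-sample t-statistic of the first
halves. -/
theorem studentizedXMMD_eq (hn : 2 ≤ n) (hm : 2 ≤ m) (x : Fin n → X) (y : Fin m → X)
    {f : X → ℝ} (hf : f = linStat (k.centered P) (contrast (n - n / 2) (m - m / 2))
      (Sum.elim (secondHalf x) (secondHalf y))) {u : Fin (n / 2) ⊕ Fin (m / 2) → X}
    (hu : u = Sum.elim (firstHalf x) (firstHalf y)) :
    studentizedXMMD k x y = (∑ i, contrast (n / 2) (m / 2) i * f (u i)) /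
      √(((n / 2 : ℕ) : ℝ)⁻¹ * empVar (fun i => f (u (Sum.inl i))) +
        ((m / 2 : ℕ) : ℝ)⁻¹ * empVar (fun j => f (u (Sum.inr j)))) := by
  have hn1 : 0 < n / 2 := by omega
  have hm1 : 0 < m / 2 := by omega
  have h1 : ((n / 2 : ℕ) : ℝ) ≠ 0 := by positivity
  have h2 : ((m / 2 : ℕ) : ℝ) ≠ 0 := by positivity
  rw [studentizedXMMD, sigmaHatSq, xMMDsq_eq hn hm, sum_contrast_mul]
  simp only [uStat_eq_linStat (P := P) hn hm, ← hf, hu, Sum.elim_inl, Sum.elim_inr]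
  rw [empVar_add_const hn1, empVar_add_const hm1]
  congr 1
  simp only [Finset.sum_add_distrib, Finset.sum_const, Finset.card_univ, Fintype.card_fin,
    nsmul_eq_mul]
  field_simp
  ring

end Algebra

section Splitting

variable {X : Type*} [MeasurableSpace X] (P : Measure X) [IsProbabilityMeasure P] (n m : ℕ)

/-- The first halves and the second halves of two samples, each pair of halves collected into one
sample. -/
def splitHalves {X : Type*} {n m : ℕ} (s : (Fin n → X) × (Fin m → X)) :
    (Fin (n / 2) ⊕ Fin (m / 2) → X) × (Fin (n - n / 2) ⊕ Fin (m - m / 2) → X) :=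
  (Sum.elim (firstHalf s.1) (firstHalf s.2), Sum.elim (secondHalf s.1) (secondHalf s.2))

/-- A sample index lies either in the first half or in the second half. -/
def halvesEquiv (r : ℕ) : Fin (r / 2) ⊕ Fin (r - r / 2) ≃ Fin r :=
  finSumFinEquiv.trans (finCongr (by omega))

theorem measurePreserving_splitHalves :
    MeasurePreserving (splitHalves (X := X) (n := n) (m := m)) (sampleLaw P n m)
      ((Measure.pi fun _ : Fin (n / 2) ⊕ Fin (m / 2) => P).prod
        (Measure.pi fun _ : Fin (n - n / 2) ⊕ Fin (m - m / 2) => P)) := by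
  set e : (Fin (n / 2) ⊕ Fin (m / 2)) ⊕ (Fin (n - n / 2) ⊕ Fin (m - m / 2)) ≃ Fin n ⊕ Fin m :=
    (Equiv.sumSumSumComm _ _ _ _).trans (Equiv.sumCongr (halvesEquiv n) (halvesEquiv m)) with he
  have h1 := (measurePreserving_sumPiEquivProdPi (fun _ : Fin n ⊕ Fin m => P)).symm
  have h2 := (measurePreserving_piCongrLeft (fun _ : Fin n ⊕ Fin m => P) e).symm
  have h3 := measurePreserving_sumPiEquivProdPi
    (fun _ : (Fin (n / 2) ⊕ Fin (m / 2)) ⊕ (Fin (n - n / 2) ⊕ Fin (m - m / 2)) => P)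
  have h := h3.comp (h2.comp h1)
  have hfun : splitHalves (X := X) (n := n) (m := m) =
      MeasurableEquiv.sumPiEquivProdPi (fun _ => X) ∘
        (MeasurableEquiv.piCongrLeft (fun _ => X) e).symm ∘
          (MeasurableEquiv.sumPiEquivProdPi fun _ => X).symm := by
    ext s i
    · rcases i with i | i <;> rfl
    · rcases i with i | i <;> rfl
  rw [hfun]
  exact h


end Splitting

/-! ### Bound for the Kolmogorov distance -/

theorem tripleMoment_nonneg {X : Type*} [MeasurableSpace X] (K : X → X → ℝ) (P : Measure X) :
    0 ≤ tripleMoment K P := integral_nonneg fun _ => by positivity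

theorem pairMoment_four_nonneg {X : Type*} [MeasurableSpace X] (K : X → X → ℝ) (P : Measure X) :
    0 ≤ pairMoment K P 4 := integral_nonneg fun _ => by positivity

/-- If all but a small proportion of the slices of `E` have measure close to `p`, then so does
`E`. -/
theorem abs_prod_real_sub_le {α β : Type*} [MeasurableSpace α] [MeasurableSpace β]
    {μ : Measure α} {ν : Measure β} [IsProbabilityMeasure μ] [IsProbabilityMeasure ν]
    {E : Set (α × β)} (hE : MeasurableSet E) {p ε₁ ε₂ : ℝ} (hp0 : 0 ≤ p) (hp1 : p ≤ 1)
    (hε₁ : 0 ≤ ε₁) {G : β → Prop} (hG : ∀ b, G b → |μ.real {a | (a, b) ∈ E} - p| ≤ ε₁)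
    (hbad : ν.real {b | ¬ G b} ≤ ε₂) : |(μ.prod ν).real E - p| ≤ ε₁ + ε₂ := by
  have hm : Measurable fun b => μ {a | (a, b) ∈ E} := measurable_measure_prodMk_right hE
  have hm' : Measurable fun b => μ.real {a | (a, b) ∈ E} := hm.ennreal_toReal
  have hslice : ∀ b, |μ.real {a | (a, b) ∈ E} - p| ≤ 1 := fun b => by
    have h1 : μ.real {a | (a, b) ∈ E} ≤ 1 := measureReal_le_one
    have h0 : 0 ≤ μ.real {a | (a, b) ∈ E} := measureReal_nonneg
    rw [abs_le]; constructor <;> linarith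
  have hI : Integrable (fun b => μ.real {a | (a, b) ∈ E}) ν :=
    Integrable.of_bound hm'.aestronglyMeasurable 1 (ae_of_all _ fun b => by
      rw [Real.norm_eq_abs, abs_of_nonneg measureReal_nonneg]; exact measureReal_le_one)
  have e : (μ.prod ν).real E = ∫ b, μ.real {a | (a, b) ∈ E} ∂ν := by
    rw [measureReal_def, Measure.prod_apply_symm hE]
    exact (integral_toReal hm.aemeasurable (ae_of_all _ fun b => measure_lt_top _ _)).symm
  -- the exceptional set need not be measurable
  set B := toMeasurable ν {b | ¬ G b} with hB
  have hBm : MeasurableSet B := measurableSet_toMeasurable _ _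
  have hBr : ν.real B = ν.real {b | ¬ G b} := by
    rw [measureReal_def, measureReal_def, hB, measure_toMeasurable]
  have e2 : (μ.prod ν).real E - p = ∫ b, (μ.real {a | (a, b) ∈ E} - p) ∂ν := by
    rw [integral_sub hI (integrable_const _), e]; simp
  have hBi : Integrable (B.indicator (1 : β → ℝ)) ν :=
    (integrable_const (1 : ℝ)).indicator hBm
  rw [e2, ← Real.norm_eq_abs]
  refine (norm_integral_le_of_norm_le (g := fun b => ε₁ + B.indicator 1 b)
    ((integrable_const _).add hBi)
    (ae_of_all _ fun b => ?_)).trans ?_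
  · rw [Real.norm_eq_abs]
    by_cases hb : G b
    · have : (0 : ℝ) ≤ B.indicator 1 b := Set.indicator_nonneg (fun _ _ => zero_le_one) _
      linarith [hG b hb]
    · have hbB : b ∈ B := subset_toMeasurable _ _ hb
      rw [Set.indicator_of_mem hbB]
      simp only [Pi.one_apply]
      linarith [hslice b]
  · rw [integral_add (integrable_const _) hBi,
      integral_indicator_one hBm]
    simp
    linarith

theorem inv_half_le {r : ℕ} (hr : 2 ≤ r) : ((r / 2 : ℕ) : ℝ)⁻¹ ≤ 3 * (r : ℝ)⁻¹ := by
  have h1 : 0 < r / 2 := by omega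
  have h2 : r ≤ 3 * (r / 2) := by omega
  have h3 : (r : ℝ) ≤ 3 * ((r / 2 : ℕ) : ℝ) := by exact_mod_cast h2
  have h4 : (0 : ℝ) < r := by positivity
  have h5 : (0 : ℝ) < ((r / 2 : ℕ) : ℝ) := by positivity
  rw [← div_eq_mul_inv, inv_eq_one_div, div_le_div_iff₀ h5 h4]
  linarith

theorem inv_sub_half_le {r : ℕ} (hr : 2 ≤ r) : ((r - r / 2 : ℕ) : ℝ)⁻¹ ≤ 3 * (r : ℝ)⁻¹ := by
  refine le_trans ?_ (inv_half_le hr)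
  have h1 : 0 < r / 2 := by omega
  have : ((r / 2 : ℕ) : ℝ) ≤ ((r - r / 2 : ℕ) : ℝ) := by
    have : r / 2 ≤ r - r / 2 := by omega
    exact_mod_cast this
  gcongr

theorem sum_contrast_pow_four_le {a b : ℕ} (ha : 0 < a) (hb : 0 < b) {s : ℝ}
    (has : (a : ℝ)⁻¹ ≤ s) (hbs : (b : ℝ)⁻¹ ≤ s) :
    ∑ i, contrast a b i ^ 4 ≤ s * (∑ i, contrast a b i ^ 2) ^ 2 := by
  rw [sum_contrast_pow_four ha hb, sum_contrast_sq ha hb]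
  have a0 : 0 < (a : ℝ)⁻¹ := by positivity
  have b0 : 0 < (b : ℝ)⁻¹ := by positivity
  have k1 := mul_le_mul_of_nonneg_right has (sq_nonneg (a : ℝ)⁻¹)
  have k2 := mul_le_mul_of_nonneg_right hbs (sq_nonneg (b : ℝ)⁻¹)
  have k3 : 0 ≤ s * ((a : ℝ)⁻¹ * (b : ℝ)⁻¹) := mul_nonneg (a0.le.trans has) (by positivity)
  nlinarith

section Measurability

variable {X : Type*} [MeasurableSpace X] {P : Measure X} {K : X → X → ℝ}

theorem measurable_empVar_comp {Ω : Type*} [MeasurableSpace Ω] {r : ℕ} {g : Fin r → Ω → ℝ}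
    (hg : ∀ i, Measurable (g i)) : Measurable fun ω => empVar fun i => g i ω := by
  unfold empVar empMean
  fun_prop

/-- The two-sample t-statistic of `linStat K w v` is jointly measurable in both samples. -/
theorem IsDegenerate.measurable_tStatistic (h : IsDegenerate K P) {ι : Type*} [Fintype ι]
    (w : ι → ℝ) (a b : ℕ) :
    Measurable fun p : (Fin a ⊕ Fin b → X) × (ι → X) =>
      (∑ i, contrast a b i * linStat K w p.2 (p.1 i)) /
        √((a : ℝ)⁻¹ * empVar (fun i => linStat K w p.2 (p.1 (Sum.inl i))) +
          (b : ℝ)⁻¹ * empVar (fun j => linStat K w p.2 (p.1 (Sum.inr j)))) := by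
  have hA : ∀ i, Measurable fun p : (Fin a ⊕ Fin b → X) × (ι → X) => linStat K w p.2 (p.1 i) :=
    fun i => (h.measurable_linStat w).comp
      (by fun_prop : Measurable fun p : (Fin a ⊕ Fin b → X) × (ι → X) => (p.2, p.1 i))
  have h1 := measurable_empVar_comp fun i => hA (Sum.inl i)
  have h2 := measurable_empVar_comp fun i => hA (Sum.inr i)
  exact (Finset.measurable_fun_sum _ fun i _ => (hA i).const_mul _).div
    ((h1.const_mul _).add (h2.const_mul _)).sqrt

end Measurability

/-- The Kolmogorov distance is small, uniformly over all kernels and distributions, as soon as the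
moment ratio is small. -/
theorem exists_kolmogorovDist_le {ε : ℝ} (hε : 0 < ε) : ∃ τ : ℝ, 0 < τ ∧
    ∀ (X : Type u) [MeasurableSpace X] (P : Measure X) [IsProbabilityMeasure P]
      (k : PosDefKernel X), Measurable (fun z : X × X => k.toFun z.1 z.2) →
      (∃ μ, k.IsMeanEmbedding P μ) →
      Integrable (fun z : X × X => k.centered P z.1 z.2 ^ 4) (P.prod P) →
      pairMoment (k.centered P) P 2 ≠ 0 → ∀ n m : ℕ, 2 ≤ n → 2 ≤ m →
      (pairMoment (k.centered P) P 4 * ((n : ℝ)⁻¹ + (m : ℝ)⁻¹) + tripleMoment (k.centered P) P) /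
        (pairMoment (k.centered P) P 2 ^ 2 * (1 / ((n : ℝ)⁻¹ + (m : ℝ)⁻¹))) ≤ τ →
      kolmogorovDist k P n m ≤ ε := by
  obtain ⟨δ, hδ, ht⟩ := exists_abs_real_tStatistic_sub_cdf_le.{u} (half_pos hε)
  obtain ⟨τ, hτ, hreg⟩ := exists_real_not_isRegularSample_le.{u} (half_pos hε) hδ
  refine ⟨τ / 9, by positivity, ?_⟩
  intro X _ P _ k hk hemb h4 hne n m hn hm hratio
  have h := PosDefKernel.isDegenerate_centered hk hemb h4
  set K := k.centered P with hK
  have hS2 : 0 < pairMoment K P 2 :=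
    lt_of_le_of_ne (integral_nonneg fun _ => sq_nonneg _) (Ne.symm hne)
  have hT := tripleMoment_nonneg K P
  have hM4 := pairMoment_four_nonneg K P
  set S2 := pairMoment K P 2 with hS2def
  set M4 := pairMoment K P 4 with hM4def
  set T := tripleMoment K P with hTdef
  have hn0 : (0 : ℝ) < n := by positivity
  have hm0 : (0 : ℝ) < m := by positivity
  set s := (n : ℝ)⁻¹ + (m : ℝ)⁻¹ with hs
  have hni : 0 < (n : ℝ)⁻¹ := by positivity
  have hmi : 0 < (m : ℝ)⁻¹ := by positivity
  have hs0 : 0 < s := by positivity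
  have hsT : (M4 * s + T) * s ≤ τ / 9 * S2 ^ 2 := by
    rw [div_le_iff₀ (by positivity)] at hratio
    calc (M4 * s + T) * s ≤ (τ / 9 * (S2 ^ 2 * (1 / s))) * s :=
          mul_le_mul_of_nonneg_right hratio hs0.le
      _ = τ / 9 * S2 ^ 2 := by field_simp
  set w := contrast (n - n / 2) (m - m / 2) with hw
  have hn1 : 0 < n / 2 := by omega
  have hm1 : 0 < m / 2 := by omega
  have hn2 : 0 < n - n / 2 := by omega
  have hm2 : 0 < m - m / 2 := by omega
  have hW : 0 < ∑ i, w i ^ 2 := by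
    rw [hw, sum_contrast_sq hn2 hm2]; positivity
  have hW4 : ∑ i, w i ^ 4 ≤ 3 * s * (∑ i, w i ^ 2) ^ 2 := by
    refine sum_contrast_pow_four_le hn2 hm2 ?_ ?_
    · have := inv_sub_half_le hn; linarith
    · have := inv_sub_half_le hm; linarith
  set W2 := ∑ i, w i ^ 2 with hW2
  set W4 := ∑ i, w i ^ 4 with hW4def
  set r : ℝ := min ((n / 2 : ℕ) : ℝ) ((m / 2 : ℕ) : ℝ) with hr
  have hn1' : (0 : ℝ) < ((n / 2 : ℕ) : ℝ) := by positivity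
  have hm1' : (0 : ℝ) < ((m / 2 : ℕ) : ℝ) := by positivity
  have hr0 : 0 < r := lt_min hn1' hm1'
  have hrs : 1 ≤ 3 * s * r := by
    have a1 := inv_half_le hn
    have a2 := inv_half_le hm
    rcases min_choice ((n / 2 : ℕ) : ℝ) ((m / 2 : ℕ) : ℝ) with hc | hc <;> rw [hr, hc]
    · rw [← inv_le_iff_one_le_mul₀ hn1']; linarith
    · rw [← inv_le_iff_one_le_mul₀ hm1']; linarith
  have c1 : W4 * T ≤ τ * (W2 * S2) ^ 2 := by
    have a1 : T * s ≤ τ / 9 * S2 ^ 2 := le_trans (by nlinarith [mul_nonneg hM4 hs0.le]) hsT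
    calc W4 * T ≤ 3 * s * W2 ^ 2 * T := mul_le_mul_of_nonneg_right hW4 hT
      _ = 3 * W2 ^ 2 * (T * s) := by ring
      _ ≤ 3 * W2 ^ 2 * (τ / 9 * S2 ^ 2) := mul_le_mul_of_nonneg_left a1 (by positivity)
      _ = τ / 3 * (W2 * S2) ^ 2 := by ring
      _ ≤ τ * (W2 * S2) ^ 2 := mul_le_mul_of_nonneg_right (by linarith) (sq_nonneg _)
  have c2 : W4 * M4 + 3 * W2 ^ 2 * T ≤ τ * (r * (W2 * S2) ^ 2) := by
    calc W4 * M4 + 3 * W2 ^ 2 * T ≤ 3 * s * W2 ^ 2 * M4 + 3 * W2 ^ 2 * T :=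
          add_le_add (mul_le_mul_of_nonneg_right hW4 hM4) le_rfl
      _ = 3 * W2 ^ 2 * (M4 * s + T) * 1 := by ring
      _ ≤ 3 * W2 ^ 2 * (M4 * s + T) * (3 * s * r) :=
          mul_le_mul_of_nonneg_left hrs (by positivity)
      _ = 9 * W2 ^ 2 * r * ((M4 * s + T) * s) := by ring
      _ ≤ 9 * W2 ^ 2 * r * (τ / 9 * S2 ^ 2) := mul_le_mul_of_nonneg_left hsT (by positivity)
      _ = _ := by ring
  have hbad := hreg X P K h hS2 _ w hW r hr0 c1 c2
  rw [kolmogorovDist]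
  refine Real.iSup_le (fun t => ?_) hε.le
  set E : Set ((Fin (n / 2) ⊕ Fin (m / 2) → X) × (Fin (n - n / 2) ⊕ Fin (m - m / 2) → X)) :=
    {p | (∑ i, contrast (n / 2) (m / 2) i * linStat K w p.2 (p.1 i)) /
      √(((n / 2 : ℕ) : ℝ)⁻¹ * empVar (fun i => linStat K w p.2 (p.1 (Sum.inl i))) +
        ((m / 2 : ℕ) : ℝ)⁻¹ * empVar (fun j => linStat K w p.2 (p.1 (Sum.inr j)))) ≤ t} with hE
  have hEm : MeasurableSet E :=
    measurableSet_le (h.measurable_tStatistic w (n / 2) (m / 2)) measurable_const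
  have hpre : {p : (Fin n → X) × (Fin m → X) | studentizedXMMD k p.1 p.2 ≤ t} =
      splitHalves ⁻¹' E := by
    ext p
    simp only [Set.mem_ofPred_eq, Set.mem_preimage, hE]
    rw [studentizedXMMD_eq (P := P) hn hm p.1 p.2 rfl rfl]
    rfl
  rw [hpre, (measurePreserving_splitHalves P n m).measureReal_preimage hEm.nullMeasurableSet]
  refine (abs_prod_real_sub_le hEm (cdf_nonneg _ _) (cdf_le_one _ _) (half_pos hε).le
    (G := IsRegularSample K P w δ r) (fun v hv => ?_) hbad).trans_eq (by ring)
  obtain ⟨hv4, hv0, hv2, hvM⟩ := hv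
  have hra : r ≤ ((n / 2 : ℕ) : ℝ) := min_le_left _ _
  have hrb : r ≤ ((m / 2 : ℕ) : ℝ) := min_le_right _ _
  refine ht X P (n / 2) (m / 2) (linStat K w v) hn1 hm1 (h.measurable_linStat_right w v) hv4 hv0
    hv2 (hvM.trans ?_) (hvM.trans ?_) t
  · exact mul_le_mul_of_nonneg_left (mul_le_mul_of_nonneg_right hra (sq_nonneg _)) hδ.le
  · exact mul_le_mul_of_nonneg_left (mul_le_mul_of_nonneg_right hrb (sq_nonneg _)) hδ.le

theorem eventually_two_le {m : ℕ → ℕ} {c : ℝ} (hc : c ≠ 0)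
    (hm : Tendsto (fun n : ℕ => (n : ℝ) / (m n : ℝ)) atTop (𝓝 c)) : ∀ᶠ n in atTop, 2 ≤ m n := by
  have h1 : ∀ᶠ n : ℕ in atTop, (n : ℝ) / (m n : ℝ) ≠ 0 := hm.eventually_ne hc
  have h2 : ∀ᶠ n : ℕ in atTop, (n : ℝ) / (m n : ℝ) < c + 1 := hm.eventually_lt_const (by linarith)
  have h3 : ∀ᶠ n : ℕ in atTop, c + 1 < n := tendsto_natCast_atTop_atTop.eventually_gt_atTop _
  filter_upwards [h1, h2, h3] with n k1 k2 k3
  have hm0 : m n ≠ 0 := fun h0 => k1 (by simp [h0])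
  have hm1 : m n ≠ 1 := fun h0 => by simp [h0] at k2; linarith
  omega

/-- Along a sequence of distributions satisfying the assumption, the Kolmogorov distance is
eventually small. -/
theorem KernelAssumption.eventually_kolmogorovDist_le {𝒳 : ℕ → Type u}
    [∀ n, MeasurableSpace (𝒳 n)] {m : ℕ → ℕ} {c : ℝ} (hc : c ≠ 0)
    (hm : Tendsto (fun n : ℕ => (n : ℝ) / (m n : ℝ)) atTop (𝓝 c))
    {k : ∀ n, PosDefKernel (𝒳 n)} {P : ∀ n, Measure (𝒳 n)}
    (hk : ∀ n, 1 ≤ n → Measurable (fun z : 𝒳 n × 𝒳 n => (k n).toFun z.1 z.2))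
    (hprob : ∀ n, 1 ≤ n → IsProbabilityMeasure (P n))
    (hemb : ∀ n, 1 ≤ n → ∃ μ, (k n).IsMeanEmbedding (P n) μ)
    (hA : KernelAssumption m (fun n => (k n).centered (P n)) P) {ε : ℝ} (hε : 0 < ε) :
    ∀ᶠ n in atTop, kolmogorovDist (k n) (P n) n (m n) ≤ ε := by
  obtain ⟨τ, hτ, hbound⟩ := exists_kolmogorovDist_le.{u} hε
  filter_upwards [hA.fourth_moment, hA.second_moment, hA.moment_ratio.eventually_le_const hτ,
    eventually_two_le hc hm, eventually_ge_atTop 2] with n h4 h2 hr hm2 hn2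
  have hn1 : 1 ≤ n := by omega
  have := hprob n hn1
  exact hbound (𝒳 n) (P n) (k n) (hk n hn1) (hemb n hn1) h4 h2 n (m n) hn2 hm2 hr

theorem kolmogorovDist_nonneg {X : Type*} [MeasurableSpace X] (k : PosDefKernel X) (P : Measure X)
    (n m : ℕ) : 0 ≤ kolmogorovDist k P n m := Real.iSup_nonneg fun _ => abs_nonneg _

/-- If `d` is eventually small along every selection from the sets `𝒬 n`, then its supremum over
`𝒬 n` tends to zero. -/
theorem tendsto_iSup_of_forall_selection {α : ℕ → Type*} {𝒬 : ∀ n, Set (α n)} {d : ∀ n, α n → ℝ}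
    (hd : ∀ n a, 0 ≤ d n a) [∀ n, Nonempty (α n)] (hne : ∀ n, 1 ≤ n → (𝒬 n).Nonempty)
    (h : ∀ a : ∀ n, α n, (∀ n, 1 ≤ n → a n ∈ 𝒬 n) → ∀ ε : ℝ, 0 < ε →
      ∀ᶠ n in atTop, d n (a n) ≤ ε) :
    Tendsto (fun n => ⨆ a : 𝒬 n, d n a) atTop (𝓝 0) := by
  rw [Metric.tendsto_nhds]
  intro ε hε
  -- `a n` exceeds `ε / 2` whenever some element of `𝒬 n` does
  have hsel : ∀ n, ∃ a : α n, 1 ≤ n → a ∈ 𝒬 n ∧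
      (d n a ≤ ε / 2 → ∀ b ∈ 𝒬 n, d n b ≤ ε / 2) := by
    intro n
    by_cases hn : 1 ≤ n
    · by_cases hex : ∃ b ∈ 𝒬 n, ε / 2 < d n b
      · obtain ⟨b, hb, hlt⟩ := hex
        exact ⟨b, fun _ => ⟨hb, fun hle => absurd hle (not_le.2 hlt)⟩⟩
      · push Not at hex
        obtain ⟨b, hb⟩ := hne n hn
        exact ⟨b, fun _ => ⟨hb, fun _ => hex⟩⟩
    · exact ⟨Classical.arbitrary _, fun h => absurd h hn⟩
  choose a ha using hsel
  filter_upwards [h a (fun n hn => (ha n hn).1) (ε / 2) (half_pos hε), eventually_ge_atTop 1]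
    with n hle hn
  have hsup : (⨆ b : 𝒬 n, d n b) ≤ ε / 2 :=
    Real.iSup_le (fun b => (ha n hn).2 hle b.1 b.2) (half_pos hε).le
  have h0 : 0 ≤ ⨆ b : 𝒬 n, d n b := Real.iSup_nonneg fun b => hd n b.1
  rw [Real.dist_eq, sub_zero, abs_of_nonneg h0]
  linarith

end CrossMMD

end

theorem mainTheorem2
    {𝒳 : ℕ → Type*} [∀ n, MeasurableSpace (𝒳 n)]
    (m : ℕ → ℕ) (c : ℝ) (hc : c ≠ 0)
    (hm : Tendsto (fun n : ℕ => (n : ℝ) / (m n : ℝ)) atTop (𝓝 c))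
    (k : ∀ n, CrossMMD.PosDefKernel (𝒳 n))
    (hk : ∀ n, 1 ≤ n → Measurable (fun z : 𝒳 n × 𝒳 n => (k n).toFun z.1 z.2))
    (𝒬 : ∀ n, Set (Measure (𝒳 n)))
    (hprob : ∀ n, 1 ≤ n → ∀ P ∈ 𝒬 n, IsProbabilityMeasure P)
    (hne : ∀ n, 1 ≤ n → (𝒬 n).Nonempty)
    (hemb : ∀ n, 1 ≤ n → ∀ P ∈ 𝒬 n, ∃ μ, (k n).IsMeanEmbedding P μ)
    (hA : ∀ P : (∀ n, Measure (𝒳 n)), (∀ n, 1 ≤ n → P n ∈ 𝒬 n) →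
      CrossMMD.KernelAssumption m (fun n => (k n).centered (P n)) P) :
    Tendsto (fun n : ℕ => ⨆ P : 𝒬 n, CrossMMD.kolmogorovDist (k n) (P : Measure (𝒳 n)) n (m n))
      atTop (𝓝 0) := by
  have (n : ℕ) : Nonempty (Measure (𝒳 n)) := ⟨0⟩
  refine CrossMMD.tendsto_iSup_of_forall_selection
    (d := fun n P => CrossMMD.kolmogorovDist (k n) P n (m n))
    (fun n P => CrossMMD.kolmogorovDist_nonneg (k n) P n (m n)) hne fun P hP ε hε => ?_
  exact (hA P hP).eventually_kolmogorovDist_le hc hm hk (fun n hn => hprob n hn _ (hP n hn))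
    (fun n hn => hemb n hn _ (hP n hn)) hε
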